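/- **Setting.** Let $C:\mathbb{R}^n\times\mathbb{R}^m\to\mathbb{R}^n$ be measurable, let $\xi$ be a random vector in $\mathbb{R}^m$ with distribution $\mathbb{P}$, and let $\alpha\in(0,1]$. Put $$F_i(h):=\operatorname{CVaR}_\alpha[C_i(h,\xi)]=\inf_{\eta\in\mathbb{R}}\big\{\eta+\alpha^{-1}\mathbb{E}[C_i(h,\xi)-\eta]^+\big\},\qquad i=1,\dots,n,$$ assumed to be well defined and finite for all $h$ and $i$, where $[x]^+=\max(x,0)$ (componentwise for vectors). Assume that $F=(F_1,\dots,F_n)$ is continuous and strictly monotone on $\mathbb{R}^n$, i.e. $(F(x)-F(y))^\top(x-y)>0$ for all $x\ne y$. Let $A\in\mathbb{R}^{l\times n}$, $b\in\mathbb{R}^l$, let $q=(q^1,\dots,q^s):\mathbb{R}^n\to\mathbb{R}^s$ have affine components, with (constant) Jacobian $Dq$, and assume that $\mathcal{H}=\{h\in\mathbb{R}^n: Ah=b,\ q(h)\le 0\}$ is compact. Let $h^*\in\operatorname{SOL}(\mathcal{H},F)$, i.e. $h^*\in\mathcal{H}$ and $(h-h^*)^\top F(h^*)\ge 0$ for all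 $h\in\mathcal{H}$. Assume the LICQ at $h^*$: the gradients $\nabla q^i(h^*)$ with $q^i(h^*)=0$ together with the rows of $A$ are linearly independent. Let $(h^*,\lambda^*,\mu^*)$ be a KKT point: $F(h^*)+Dq^\top\lambda^*+A^\top\mu^*=0$, $Ah^*=b$, $q(h^*)\le 0$, $\lambda^*\ge 0$, $\lambda^{*\top}q(h^*)=0$. **Algorithm.** Let $u_1,\dots,u_n$ be an orthonormal basis of $\mathbb{R}^n$ whose first $M$ vectors span the row space of $A$, and let $L=I-\sum_{i=1}^M u_iu_i^\top$. Let $(\xi^k_j)_{k\ge 0,\,j\ge 1}$ be i.i.d. samples of $\xi$, let $(\gamma^k)_{k\ge0}$ be positive step sizes with $\sum_k\gamma^k=\infty$ and $\sum_k(\gamma^k)^2<\infty$, let $(N_k)_{k\ge0}$ be natural numbers, and let $h^0\in\mathbb{R}^n$ with $Ah^0=b$ and $\lambda^0\in\mathbb{R}^s_{\ge 0}$. For $k\ge 0$ put $$h^{k+1}=h^k-\gamma^kL\big(F(h^k)+Dq^\top\lambda^k+\widehat\beta^{N_k}\big),\qquad \lambda^{k+1}=\big[\lambda^k+\gamma^kq(h^k)\big]^+,$$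 where $\widehat\beta^{N_k}=\widehat F^{N_k}(h^k)-F(h^k)$ is the error of the empirical estimate $$\widehat F^{N_k}_i(h^k)=\inf_{\eta\in\mathbb{R}}\Big\{\eta+(N_k\alpha)^{-1}\sum_{j=1}^{N_k}\big[C_i(h^k,\xi^k_j)-\eta\big]^+\Big\}.$$ **Claim.** For every $\epsilon>0$ and every $B\in\mathbb{R}$ there is $N_\epsilon\in\mathbb{N}$, depending only on $\epsilon$, $B$ and the data $C,\mathbb{P},\alpha,A,b,q$ (not on the step sizes, the initial values, the samples or $(N_k)$), with the following property. If, with probability one, $\|h^k\|\le B$, $\|\lambda^k\|\le B$ and $\|\widehat\beta^{N_k}\|\le B$ for all $k$, and if $N_k\ge N_\epsilon$ for all $k$, then, with probability one, $$\limsup_{k\to\infty}\|h^k-h^*\|\le\epsilon .$$ -/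

import Mathlib

open Set Filter Topology MeasureTheory ProbabilityTheory
open scoped Matrix

noncomputable section

namespace CVaRVI

/-- `ℝⁿ` with the Euclidean norm and inner product. -/
abbrev Vec (n : ℕ) : Type := EuclideanSpace ℝ (Fin n)

/-! ### Conditional value-at-risk and its empirical estimate -/

/-- `η + α⁻¹ 𝔼[Z - η]⁺`. -/
def cvarObjective {X : Type*} [MeasurableSpace X] (α : ℝ) (P : Measure X) (Z : X → ℝ)
    (η : ℝ) : ℝ :=
  η + α⁻¹ * ∫ x, max (Z x - η) 0 ∂P

/-- `CVaR_α[Z] = inf_η { η + α⁻¹ 𝔼[Z - η]⁺ }`. -/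
def CVaR {X : Type*} [MeasurableSpace X] (α : ℝ) (P : Measure X) (Z : X → ℝ) : ℝ :=
  ⨅ η : ℝ, cvarObjective α P Z η

/-- The CVaR of `Z` is a real number: the expectations in its definition are finite and the
infimum is not `-∞`. -/
def HasFiniteCVaR {X : Type*} [MeasurableSpace X] (α : ℝ) (P : Measure X) (Z : X → ℝ) : Prop :=
  (∀ η : ℝ, Integrable (fun x => max (Z x - η) 0) P) ∧
    BddBelow (range (cvarObjective α P Z))

/-- The empirical CVaR `inf_η { η + (N α)⁻¹ ∑_{j < N} [z j - η]⁺ }` of the samples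
`z 0, …, z (N - 1)`. -/
def empCVaR (α : ℝ) (N : ℕ) (z : ℕ → ℝ) : ℝ :=
  ⨅ η : ℝ, (η + ((N : ℝ) * α)⁻¹ * ∑ j ∈ Finset.range N, max (z j - η) 0)

/-- `F(h) = (CVaR_α[C_i(h, ξ)])_i`, where `ξ` has distribution `P`. -/
def cvarMap {n m : ℕ} (α : ℝ) (P : Measure (Vec m)) (C : Vec n → Vec m → Vec n)
    (h : Vec n) : Vec n :=
  WithLp.toLp 2 fun i => CVaR α P fun x => C h x i

/-- The estimator of `F(h)` from the samples `x 0, …, x (N - 1)` of `ξ`; all components use the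
same samples. -/
def empMap {n m : ℕ} (α : ℝ) (C : Vec n → Vec m → Vec n) (N : ℕ) (x : ℕ → Vec m)
    (h : Vec n) : Vec n :=
  WithLp.toLp 2 fun i => empCVaR α N fun j => C h (x j) i

/-- The estimation error: estimator at `h` minus `F(h)`. -/
def estError {n m : ℕ} (α : ℝ) (P : Measure (Vec m)) (C : Vec n → Vec m → Vec n) (N : ℕ)
    (x : ℕ → Vec m) (h : Vec n) : Vec n :=
  empMap α C N x h - cvarMap α P C h

/-! ### Variational inequalities -/

/-- `{h | A h = b, q^i(h) ≤ 0 for all i}`. -/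
def feasibleSet {n l s : ℕ} (A : Matrix (Fin l) (Fin n) ℝ) (b : Fin l → ℝ)
    (q : Fin s → Vec n → ℝ) : Set (Vec n) :=
  {h | A *ᵥ h.ofLp = b ∧ ∀ i, q i h ≤ 0}

/-- The solution set of `VI(H, F)`. -/
def SOL {n : ℕ} (H : Set (Vec n)) (F : Vec n → Vec n) : Set (Vec n) :=
  {h | h ∈ H ∧ ∀ y ∈ H, 0 ≤ inner ℝ (y - h) (F h)}

/-- Strict monotonicity of a map. -/
def IsStrictlyMonotone {n : ℕ} (F : Vec n → Vec n) : Prop :=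
  ∀ x y : Vec n, x ≠ y → 0 < inner ℝ (F x - F y) (x - y)

/-- The `j`-th row of `A` as a vector of `ℝⁿ`. -/
def rowVec {n l : ℕ} (A : Matrix (Fin l) (Fin n) ℝ) (j : Fin l) : Vec n :=
  WithLp.toLp 2 (A j)

/-- `Dq(h)ᵀ v = ∑ i, v_i ∇q^i(h)`. -/
def jacobianTransposeMul {n s : ℕ} (q : Fin s → Vec n → ℝ) (h : Vec n) (v : Vec s) : Vec n :=
  ∑ i, v i • gradient (q i) h

/-- Linear independence constraint qualification at `h`: the gradients of the active inequality
constraints and the rows of `A` are, together, linearly independent. -/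
def LICQ {n l s : ℕ} (A : Matrix (Fin l) (Fin n) ℝ) (q : Fin s → Vec n → ℝ) (h : Vec n) : Prop :=
  LinearIndependent ℝ
    (Sum.elim (fun i : {i : Fin s // q i h = 0} => gradient (q i) h) (rowVec A))

/-- `(h, lam, mu)` is a KKT point of `VI(H, F)` with `H = feasibleSet A b q`. -/
structure IsKKTPoint {n l s : ℕ} (F : Vec n → Vec n) (A : Matrix (Fin l) (Fin n) ℝ)
    (b : Fin l → ℝ) (q : Fin s → Vec n → ℝ) (h : Vec n) (lam : Vec s) (mu : Vec l) : Prop where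
  stationary : F h + jacobianTransposeMul q h lam + WithLp.toLp 2 (Aᵀ *ᵥ mu.ofLp) = 0
  eq_constraint : A *ᵥ h.ofLp = b
  ineq_constraint : ∀ i, q i h ≤ 0
  multiplier_nonneg : ∀ i, 0 ≤ lam i
  complementarity : ∑ i, lam i * q i h = 0

/-! ### The multiplier-driven algorithm -/

/-- Multiplication by `L = I - ∑_{i < M} u_i u_iᵀ`. -/
def subspaceProj {n : ℕ} (u : OrthonormalBasis (Fin n) ℝ (Vec n)) (M : ℕ) (v : Vec n) : Vec n :=
  v - ∑ i ∈ Finset.univ.filter (fun i : Fin n => i.val < M), inner ℝ (u i) v • u i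

/-- The first `M` vectors of `u` span the row space of `A`. -/
def SpansRows {n l : ℕ} (A : Matrix (Fin l) (Fin n) ℝ) (u : OrthonormalBasis (Fin n) ℝ (Vec n))
    (M : ℕ) : Prop :=
  M ≤ n ∧ Submodule.span ℝ (u '' {i : Fin n | i.val < M}) = Submodule.span ℝ (range (rowVec A))

/-- The iterates `(h^k, λ^k)` of
`h^{k+1} = h^k - γ^k L (F(h^k) + Dq(h^k)ᵀ λ^k + β^k)`, `λ^{k+1} = [λ^k + γ^k q(h^k)]⁺`,
where `β^k` is the error at `h^k` of the estimator of `F` built from the samples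
`x k 0, …, x k (N k - 1)`. -/
def iter {n m s : ℕ} (α : ℝ) (P : Measure (Vec m)) (C : Vec n → Vec m → Vec n)
    (q : Fin s → Vec n → ℝ) (L : Vec n → Vec n) (γ : ℕ → ℝ) (N : ℕ → ℕ)
    (h₀ : Vec n) (lam₀ : Vec s) (x : ℕ → ℕ → Vec m) : ℕ → Vec n × Vec s
  | 0 => (h₀, lam₀)
  | k + 1 =>
    let h := (iter α P C q L γ N h₀ lam₀ x k).1
    let lam := (iter α P C q L γ N h₀ lam₀ x k).2
    (h - γ k • L (cvarMap α P C h + jacobianTransposeMul q h lam + estError α P C (N k) (x k) h),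
      WithLp.toLp 2 fun i => max (lam i + γ k * q i h) 0)

end CVaRVI

end

namespace CVaRVI

/-! Along the primal-dual iteration the squared distance to `(hstar, lamstar)` falls at rate `2γ (φ
+ σ)`, with `φ` the monotonicity gap `⟨F h - F hstar, h - hstar⟩` and `σ = ∑ λ_i (-q_i(hstar))`, up
to terms in `γ ‖β‖` and `γ²`. This rate vanishes when `h = hstar` and `λ` is supported on the active
constraints, however far `λ` is from `lamstar`. Since the noise has a size that need not tend to
zero, a rate bounded away from zero outside a small neighbourhood is needed.

The remedy is a small cross term `κ ⟨h - hstar, G (λ - lamstar)⟩`, where `G` combines the active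
gradients. Its increment contains `-γ κ ‖L G (λ - lamstar)‖²`, and LICQ makes this control the
active multiplier errors, while `σ` controls the inactive ones. Compactness of the region of norm at
most `B` and strict monotonicity then yield a uniform rate `θ` outside a sublevel set lying inside
the `ε`-ball (`exists_lyapunov`).

For the noise, an almost sure bound `B` on the estimation error forces `C_i(h, ξ)` into an interval
of length `2B`: otherwise, with positive probability, all samples lie beyond the same end of it, and
so does the empirical CVaR. On such an interval both CVaR objectives can be compared on a finite
grid, where second moments give an expected error below any `τ`, uniformly in `h`
(`exists_integral_norm_estError_le`). As the samples are fresh, the same `τ` bounds the conditional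
expectation of `‖β^k‖`, and the centered sums `∑ γ^k (‖β^k‖ - e_k)` converge by martingale
convergence (`ae_exists_compensator`). With `K τ = θ / 2`, half the rate survives, and
`eventually_le_of_descent` concludes path by path. -/

/-! ### Deterministic descent with summable errors. -/

/-- A perturbed descent recursion: a sequence that decreases at rate `θ` above the level `c`, up to
summable errors, eventually stays below `c + η`. -/
theorem eventually_le_of_descent {W γ r t : ℕ → ℝ} {c θ η a : ℝ} (hθ : 0 < θ) (hη : 0 < η)
    (hγ : ∀ k, 0 ≤ γ k) (hγs : Tendsto (fun K => ∑ k ∈ Finset.range K, γ k) atTop atTop)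
    (hr : Tendsto (fun K => ∑ k ∈ Finset.range K, r k) atTop (𝓝 a))
    (ht : Tendsto t atTop (𝓝 0))
    (hdesc : ∀ᶠ k in atTop, c ≤ W k → W (k + 1) ≤ W k - γ k * θ + r k)
    (hstep : ∀ᶠ k in atTop, W (k + 1) ≤ W k + t k) :
    ∀ᶠ k in atTop, W k ≤ c + η := by
  set S : ℕ → ℝ := fun K => ∑ k ∈ Finset.range K, r k with hS
  set G : ℕ → ℝ := fun K => ∑ k ∈ Finset.range K, γ k with hG
  have hSs : ∀ k, S (k + 1) = S k + r k := fun k => Finset.sum_range_succ _ _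
  have hGs : ∀ k, G (k + 1) = G k + γ k := fun k => Finset.sum_range_succ _ _
  have h1 : ∀ᶠ k in atTop, |S k - a| ≤ η / 4 := by
    have := (hr.sub_const a).abs
    rw [sub_self, abs_zero] at this
    exact (this.eventually_lt_const (by positivity : 0 < η / 4)).mono fun k hk => hk.le
  have h2 : ∀ᶠ k in atTop, t k ≤ η / 2 :=
    (ht.eventually_lt_const (by positivity : 0 < η / 2)).mono fun k hk => hk.le
  obtain ⟨k₀, hk₀⟩ := eventually_atTop.1 (h1.and (h2.and (hdesc.and hstep)))
  -- Staying above `c` forever would drive `W` below `c`, because the steps have infinite sum.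
  have hex : ∃ k₁ ≥ k₀, W k₁ < c := by
    by_contra! hno
    have hbd : ∀ k ≥ k₀, W k ≤ W k₀ - (G k - G k₀) * θ + (S k - S k₀) := by
      intro k hk
      induction k, hk using Nat.le_induction with
      | base => simp
      | succ k hk ih =>
        have := (hk₀ k hk).2.2.1 (hno k hk)
        rw [hGs, hSs]; linarith
    obtain ⟨k, hk, hkG⟩ := ((eventually_ge_atTop k₀).and
      (hγs.eventually_gt_atTop (G k₀ + (W k₀ - c + η) / θ))).exists
    have e1 := hbd k hk
    have e2 := hno k hk
    have e3 := abs_le.1 (hk₀ k hk).1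
    have e4 := abs_le.1 (hk₀ k₀ le_rfl).1
    have e5 : (W k₀ - c + η) / θ < G k - G k₀ := by
      have : G k₀ + (W k₀ - c + η) / θ < G k := hkG
      linarith
    rw [div_lt_iff₀ hθ] at e5
    linarith [e3.2, e4.1]
  obtain ⟨k₁, hk₁, hWk₁⟩ := hex
  -- Here `j` marks the last crossing from below `c`. That crossing overshoots by at most `η / 2`,
  -- and later only the tail `S k - S j` of the error sums, again at most `η / 2`, can raise `W`.
  have hinv : ∀ k ≥ k₁, ∃ j ≥ k₀, W k ≤ c + η / 2 + (S k - S j) := by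
    intro k hk
    induction k, hk using Nat.le_induction with
    | base => exact ⟨k₁, hk₁, by linarith⟩
    | succ k hk ih =>
      have hk' := hk₀ k (hk₁.le.trans hk)
      by_cases hc : c ≤ W k
      · obtain ⟨j, hj, hW⟩ := ih
        refine ⟨j, hj, ?_⟩
        have := hk'.2.2.1 hc
        have := mul_nonneg (hγ k) hθ.le
        rw [hSs]; linarith
      · refine ⟨k + 1, by omega, ?_⟩
        have := hk'.2.2.2
        have := hk'.2.1
        rw [not_le] at hc
        linarith
  filter_upwards [eventually_ge_atTop k₁] with k hk
  obtain ⟨j, hj, hW⟩ := hinv k hk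
  have e3 := abs_le.1 (hk₀ k (hk₁.le.trans hk)).1
  have e4 := abs_le.1 (hk₀ j hj).1
  linarith [e3.2, e4.1]

/-! ### The Lyapunov function and its one-step decrease. -/

/-- The linear map `v ↦ ∑ i, v_i g_i`. -/
noncomputable def combination {n s : ℕ} (g : Fin s → Vec n) : Vec s →L[ℝ] Vec n :=
  ∑ i, (EuclideanSpace.proj i : Vec s →L[ℝ] ℝ).smulRight (g i)

theorem combination_apply {n s : ℕ} (g : Fin s → Vec n) (v : Vec s) :
    combination g v = ∑ i, v i • g i := by
  simp [combination]

/-- The multiplier update `[λ + γ w]⁺`. -/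
noncomputable def dualStep {s : ℕ} (lam : Vec s) (γ : ℝ) (w : Vec s) : Vec s :=
  WithLp.toLp 2 fun i => max (lam i + γ * w i) 0

/-- The positive part is nonexpansive and fixes nonnegative vectors. The same fact, applied around
`lamstar`, gives the quadratic estimate that follows. -/
theorem norm_dualStep_sub_le {s : ℕ} {lam : Vec s} (hlam : ∀ i, 0 ≤ lam i) {γ : ℝ} (hγ : 0 ≤ γ)
    (w : Vec s) : ‖dualStep lam γ w - lam‖ ≤ γ * ‖w‖ := by
  have : ‖dualStep lam γ w - lam‖ ≤ ‖γ • w‖ := by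
    rw [← sq_le_sq₀ (norm_nonneg _) (norm_nonneg _), EuclideanSpace.norm_sq_eq,
      EuclideanSpace.norm_sq_eq]
    refine Finset.sum_le_sum fun i _ => ?_
    rw [sq_le_sq₀ (norm_nonneg _) (norm_nonneg _)]
    simp only [dualStep, PiLp.sub_apply, PiLp.smul_apply, smul_eq_mul, Real.norm_eq_abs]
    have h1 : max (lam i + γ * w i) 0 - lam i = max (lam i + γ * w i) 0 - max (lam i) 0 := by
      rw [max_eq_left (hlam i)]
    rw [h1]
    refine (abs_max_sub_max_le_abs _ _ _).trans ?_
    simp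
  rwa [norm_smul, Real.norm_of_nonneg hγ] at this

theorem norm_sq_dualStep_sub_le {s : ℕ} (lam : Vec s) {lamstar : Vec s}
    (hls : ∀ i, 0 ≤ lamstar i) (γ : ℝ) (w : Vec s) :
    ‖dualStep lam γ w - lamstar‖ ^ 2 ≤
      ‖lam - lamstar‖ ^ 2 + 2 * γ * ∑ i, (lam i - lamstar i) * w i + γ ^ 2 * ‖w‖ ^ 2 := by
  simp only [EuclideanSpace.norm_sq_eq, Finset.mul_sum, ← Finset.sum_add_distrib]
  refine Finset.sum_le_sum fun i _ => ?_
  simp only [dualStep, PiLp.sub_apply, Real.norm_eq_abs, sq_abs]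
  have h1 : |max (lam i + γ * w i) 0 - lamstar i| ≤ |lam i + γ * w i - lamstar i| := by
    have := abs_max_sub_max_le_abs (lam i + γ * w i) (lamstar i) 0
    rwa [max_eq_left (hls i)] at this
  have := sq_le_sq.2 h1
  nlinarith

/-- The squared distance to a primal-dual point, with a cross term of weight `κ`. -/
noncomputable def lyapunov {n s : ℕ} (G : Vec s →L[ℝ] Vec n) (hstar : Vec n) (lamstar : Vec s)
    (κ : ℝ) (h : Vec n) (lam : Vec s) : ℝ :=
  ‖h - hstar‖ ^ 2 + ‖lam - lamstar‖ ^ 2 + κ * inner ℝ (h - hstar) (G (lam - lamstar))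

/-- The skew coupling of primal and dual steps cancels: `⟨d, G (λ - lamstar)⟩` equals `∑ (λ_i -
lamstar_i)(qv_i - qs_i)`, whose `qv` part is exactly the gain of the dual step. Complementarity
reduces the rest to `∑ λ_i (-qs_i)`. The projection drops out because `d` lies in its range. -/
theorem dist_sq_step_le {n s : ℕ} (S : Submodule ℝ (Vec n)) (g : Fin s → Vec n)
    {h hstar : Vec n} (hd : h - hstar ∈ Sᗮ) (p β : Vec n) {lam lamstar qv qs : Vec s}
    (hls : ∀ i, 0 ≤ lamstar i) (hcompl : ∀ i, lamstar i * qs i = 0)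
    (hqv : ∀ i, qv i - qs i = inner ℝ (g i) (h - hstar)) (γ : ℝ) (hγ : 0 ≤ γ) (w : Vec n)
    (hw : w = Sᗮ.starProjection (p + combination g (lam - lamstar) + β)) :
    ‖h - γ • w - hstar‖ ^ 2 + ‖dualStep lam γ qv - lamstar‖ ^ 2 ≤
      ‖h - hstar‖ ^ 2 + ‖lam - lamstar‖ ^ 2
        - 2 * γ * (inner ℝ p (h - hstar) + ∑ i, lam i * -qs i)
        + 2 * γ * ‖h - hstar‖ * ‖β‖ + γ ^ 2 * (‖w‖ ^ 2 + ‖qv‖ ^ 2) := by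
  set d := h - hstar with hddef
  have e1 : h - γ • w - hstar = d - γ • w := by rw [hddef]; abel
  have e2 : ‖d - γ • w‖ ^ 2 = ‖d‖ ^ 2 - 2 * γ * inner ℝ d w + γ ^ 2 * ‖w‖ ^ 2 := by
    rw [norm_sub_sq_real, inner_smul_right, norm_smul, mul_pow, Real.norm_eq_abs, sq_abs]; ring
  have e3 : inner ℝ d w = inner ℝ p d + inner ℝ d (combination g (lam - lamstar))
      + inner ℝ d β := by
    rw [hw, ← Submodule.inner_starProjection_left_eq_right,
      Submodule.starProjection_eq_self_iff.2 hd, inner_add_right, inner_add_right,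
      real_inner_comm p]
  have e4 : inner ℝ d (combination g (lam - lamstar)) =
      ∑ i, (lam i - lamstar i) * qv i + ∑ i, lam i * -qs i := by
    rw [combination_apply, inner_sum, ← Finset.sum_add_distrib]
    refine Finset.sum_congr rfl fun i _ => ?_
    rw [inner_smul_right, real_inner_comm, ← hqv, PiLp.sub_apply]
    linear_combination hcompl i
  have e5 := norm_sq_dualStep_sub_le lam hls γ qv
  have e6 : -(‖d‖ * ‖β‖) ≤ inner ℝ d β := (abs_le.1 (abs_real_inner_le_norm d β)).1
  rw [e1, e2, e3, e4]
  nlinarith [mul_le_mul_of_nonneg_left e6 hγ]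

/-- The primal direction `w` contains the projection of `a = G_a (λ - lamstar)`, so moving `h` by
`-γ w` changes the inner product with `a` by `-γ ‖L a‖²`. This is the dissipation in the multiplier
that the squared distance lacks; all other contributions are treated as errors. -/
theorem cross_step_le {n s : ℕ} (S : Submodule ℝ (Vec n)) (g ga gi : Fin s → Vec n)
    (hg : combination g = combination ga + combination gi) (h hstar p β : Vec n)
    {lam lamstar qv : Vec s} (hlam : ∀ i, 0 ≤ lam i) (γ : ℝ) (hγ : 0 ≤ γ) (w : Vec n)
    (hw : w = Sᗮ.starProjection (p + combination g (lam - lamstar) + β)) :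
    inner ℝ (h - γ • w - hstar) (combination ga (dualStep lam γ qv - lamstar)) ≤
      inner ℝ (h - hstar) (combination ga (lam - lamstar))
        - γ * ‖Sᗮ.starProjection (combination ga (lam - lamstar))‖ ^ 2
        + γ * (‖combination ga (lam - lamstar)‖
            * (‖p‖ + ‖combination gi (lam - lamstar)‖ + ‖β‖))
        + γ * ((‖h - hstar‖ + γ * ‖w‖) * (‖combination ga‖ * ‖qv‖)) := by
  set d := h - hstar with hddef
  set a := combination ga (lam - lamstar) with ha
  set x := combination gi (lam - lamstar) with hx
  set dl := dualStep lam γ qv - lam with hdl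
  have e1 : h - γ • w - hstar = d - γ • w := by rw [hddef]; abel
  have e2 : combination ga (dualStep lam γ qv - lamstar) = a + combination ga dl := by
    rw [ha, ← map_add]; congr 1; rw [hdl]; abel
  have e3 : inner ℝ w a = ‖Sᗮ.starProjection a‖ ^ 2
      + inner ℝ (p + x + β) (Sᗮ.starProjection a) := by
    have : p + combination g (lam - lamstar) + β = a + (p + x + β) := by
      rw [hg, add_apply]; abel
    rw [hw, this, Submodule.inner_starProjection_left_eq_right, inner_add_left,
      ← Submodule.inner_starProjection_left_eq_right, ← real_inner_self_eq_norm_sq]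
    congr 1
    rw [Submodule.inner_starProjection_left_eq_right,
      Submodule.inner_starProjection_left_eq_right,
      Submodule.starProjection_eq_self_iff.2 (Submodule.starProjection_apply_mem _ _)]
  have e4 : -(‖a‖ * (‖p‖ + ‖x‖ + ‖β‖)) ≤ inner ℝ (p + x + β) (Sᗮ.starProjection a) := by
    have h1 := (abs_le.1 (abs_real_inner_le_norm (p + x + β) (Sᗮ.starProjection a))).1
    have h2 : ‖p + x + β‖ * ‖Sᗮ.starProjection a‖ ≤ (‖p‖ + ‖x‖ + ‖β‖) * ‖a‖ :=
      mul_le_mul norm_add₃_le (Submodule.norm_starProjection_apply_le _ _) (norm_nonneg _)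
        (by positivity)
    linarith
  have e5 : inner ℝ (d - γ • w) (combination ga dl) ≤
      γ * ((‖d‖ + γ * ‖w‖) * (‖combination ga‖ * ‖qv‖)) := by
    have h1 := real_inner_le_norm (d - γ • w) (combination ga dl)
    have h2 : ‖d - γ • w‖ ≤ ‖d‖ + γ * ‖w‖ := by
      refine (norm_sub_le _ _).trans_eq ?_
      rw [norm_smul, Real.norm_of_nonneg hγ]
    have h3 : ‖combination ga dl‖ ≤ ‖combination ga‖ * (γ * ‖qv‖) :=
      (ContinuousLinearMap.le_opNorm _ _).trans
        (mul_le_mul_of_nonneg_left (norm_dualStep_sub_le hlam hγ qv) (norm_nonneg _))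
    have h4 := mul_le_mul h2 h3 (norm_nonneg _) (by positivity)
    linarith
  have e6 : inner ℝ (d - γ • w) (a + combination ga dl) =
      inner ℝ d a - γ * inner ℝ w a + inner ℝ (d - γ • w) (combination ga dl) := by
    rw [inner_add_right, inner_sub_left d, inner_smul_left]; simp
  rw [e1, e2, e6, e3]
  nlinarith [mul_le_mul_of_nonneg_left e4 hγ]

/-- The vector of constraint values at `h`. -/
def constraintVec {n s : ℕ} (q : Fin s → Vec n → ℝ) (h : Vec n) : Vec s :=
  WithLp.toLp 2 fun i => q i h

theorem exists_norm_bound_of_continuous {E F : Type*} [NormedAddCommGroup E] [ProperSpace E]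
    [NormedAddCommGroup F] {f : E → F} (hf : Continuous f) (B : ℝ) :
    ∃ K, 0 ≤ K ∧ ∀ x, ‖x‖ ≤ B → ‖f x‖ ≤ K := by
  obtain ⟨K, hK⟩ := (isCompact_closedBall (0 : E) B).exists_bound_of_continuousOn hf.continuousOn
  exact ⟨max K 0, le_max_right _ _, fun x hx =>
    (hK x (by simpa using hx)).trans (le_max_left _ _)⟩

/-- The arithmetic that combines the estimates for the squared distance and the cross term. -/
theorem add_mul_step_le {V V' X X' γ κ φ σ ℓ p d b w v a x R Γ Q k Kw K : ℝ}
    (hγ : 0 ≤ γ) (hκ0 : 0 ≤ κ) (hκ1 : κ ≤ 1) (hσ : 0 ≤ σ) (hp : 0 ≤ p) (hd : 0 ≤ d)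
    (hb : 0 ≤ b) (hw : 0 ≤ w) (hv : 0 ≤ v) (hΓ : 0 ≤ Γ) (hQ : 0 ≤ Q) (hR : 0 ≤ R)
    (hx : 0 ≤ x) (hKw : 0 ≤ Kw)
    (hV : V' ≤ V - 2 * γ * (φ + σ) + 2 * γ * d * b + γ ^ 2 * (w ^ 2 + v ^ 2))
    (hX : X' ≤ X - γ * ℓ + γ * (a * (p + x + b)) + γ * ((d + γ * w) * (Γ * v)))
    (hwK : w ≤ Kw) (hvQ : v ≤ Q) (haR : a ≤ Γ * R) (hxk : x ≤ k * σ) (hdR : d ≤ R)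
    (h1 : Γ * R ≤ K) (h2 : Γ * R * k ≤ K) (h3 : Γ * Q ≤ K) (h4 : Γ * R + 2 * R ≤ K)
    (h5 : Kw ^ 2 + Q ^ 2 + Kw * (Γ * Q) ≤ K) :
    V' + κ * X' ≤ V + κ * X - γ * (2 * φ + 2 * σ + κ * ℓ - κ * K * (p + σ + d))
      + γ * K * b + K * γ ^ 2 := by
  have b1 : w ^ 2 + v ^ 2 ≤ Kw ^ 2 + Q ^ 2 := by gcongr
  have b2 : a * (p + x + b) ≤ Γ * R * (p + k * σ + b) := by gcongr
  have b3 : (d + γ * w) * (Γ * v) ≤ (d + γ * Kw) * (Γ * Q) := by gcongr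
  have b4 : d * b ≤ R * b := by gcongr
  have c1 : Γ * R * p ≤ K * p := by gcongr
  have c2 : Γ * R * k * σ ≤ K * σ := by gcongr
  have c3 : Γ * Q * d ≤ K * d := by gcongr
  have c4 : (Γ * R + 2 * R) * b ≤ K * b := by gcongr
  have c5 : (Kw ^ 2 + Q ^ 2 + Kw * (Γ * Q)) * γ ^ 2 ≤ K * γ ^ 2 := by gcongr
  have X1 : X' ≤ X - γ * ℓ + γ * (K * (p + σ + d))
      + (γ * (Γ * R * b) + γ ^ 2 * (Kw * (Γ * Q))) := by
    have t1 := mul_le_mul_of_nonneg_left b2 hγ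
    have t2 := mul_le_mul_of_nonneg_left b3 hγ
    have t3 := mul_le_mul_of_nonneg_left (add_le_add (add_le_add c1 c2) c3) hγ
    linarith
  have X2 := mul_le_mul_of_nonneg_left X1 hκ0
  have X3 : κ * (γ * (Γ * R * b) + γ ^ 2 * (Kw * (Γ * Q))) ≤
      γ * (Γ * R * b) + γ ^ 2 * (Kw * (Γ * Q)) :=
    mul_le_of_le_one_left (by positivity) hκ1
  have V1 := mul_le_mul_of_nonneg_left b4 hγ
  have V2 := mul_le_mul_of_nonneg_left b1 (sq_nonneg γ)
  have V3 := mul_le_mul_of_nonneg_left c4 hγ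
  linarith

set_option maxHeartbeats 400000 in
/-- Uniform constants in the one-step estimate for the Lyapunov function. -/
theorem exists_lyapunov_step_bound {n s : ℕ} {F : Vec n → Vec n} (hF : Continuous F)
    (S : Submodule ℝ (Vec n)) (g : Fin s → Vec n) (q : Fin s → Vec n → ℝ)
    (hq : ∀ i x y, q i x - q i y = inner ℝ (g i) (x - y)) (hstar : Vec n) (lamstar : Vec s)
    (hls : ∀ i, 0 ≤ lamstar i) (hfeas : ∀ i, q i hstar ≤ 0)
    (hcompl : ∀ i, lamstar i * q i hstar = 0)
    (hstat : F hstar + combination g lamstar ∈ S)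
    (hlicq : ∃ c, 0 ≤ c ∧ ∀ v : Vec s, (∀ i, q i hstar ≠ 0 → v i = 0) →
      ‖v‖ ^ 2 ≤ c * ‖Sᗮ.starProjection (combination g v)‖ ^ 2) (B : ℝ) (hB : 0 ≤ B) :
    ∃ (G : Vec s →L[ℝ] Vec n) (K : ℝ), 1 ≤ K ∧ ∀ (h : Vec n) (lam : Vec s),
      ‖h‖ ≤ B → ‖lam‖ ≤ B → (∀ i, 0 ≤ lam i) → h - hstar ∈ Sᗮ →
      ‖h - hstar‖ ≤ K ∧ ‖F h - F hstar‖ ≤ K ∧ 0 ≤ ∑ i, lam i * -q i hstar ∧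
      ∑ i, lam i * -q i hstar ≤ K ∧
      |inner ℝ (h - hstar) (G (lam - lamstar))| ≤ K ∧
      ‖lam - lamstar‖ ^ 2 ≤ K * (‖Sᗮ.starProjection (G (lam - lamstar))‖ ^ 2
        + ∑ i, lam i * -q i hstar) ∧
      ∀ (β : Vec n) (κ γ : ℝ), ‖β‖ ≤ B → 0 ≤ κ → κ ≤ 1 → 0 ≤ γ →
        lyapunov G hstar lamstar κ
            (h - γ • Sᗮ.starProjection (F h + combination g lam + β))
            (dualStep lam γ (constraintVec q h)) ≤
          lyapunov G hstar lamstar κ h lam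
            - γ * (2 * inner ℝ (F h - F hstar) (h - hstar) + 2 * ∑ i, lam i * -q i hstar
              + κ * ‖Sᗮ.starProjection (G (lam - lamstar))‖ ^ 2
              - κ * K * (‖F h - F hstar‖ + ∑ i, lam i * -q i hstar + ‖h - hstar‖))
            + γ * K * ‖β‖ + K * γ ^ 2 := by
  classical
  have hqc : Continuous (constraintVec q) := by
    refine (PiLp.continuous_toLp 2 _).comp (continuous_pi fun i => ?_)
    have : q i = fun x => q i hstar + inner ℝ (g i) (x - hstar) := by
      ext x; linarith [hq i x hstar]
    rw [this]; fun_prop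
  obtain ⟨P, hP0, hP⟩ := exists_norm_bound_of_continuous (hF.sub (continuous_const (y := F hstar))) B
  obtain ⟨Q, hQ0, hQ⟩ := exists_norm_bound_of_continuous hqc B
  obtain ⟨c, hc0, hc⟩ := hlicq
  -- Only the gradients active at `hstar` enter the cross term, since LICQ says nothing about the
  -- others.
  set ga : Fin s → Vec n := fun i => if q i hstar = 0 then g i else 0 with hga
  set gi : Fin s → Vec n := fun i => if q i hstar = 0 then 0 else g i with hgi
  have hg : combination g = combination ga + combination gi := by
    ext1 v
    rw [add_apply, combination_apply, combination_apply, combination_apply,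
      ← Finset.sum_add_distrib]
    refine Finset.sum_congr rfl fun i _ => ?_
    by_cases hi : q i hstar = 0 <;> simp [hga, hgi, hi]
  set G := combination ga with hG
  set Γ := ‖G‖
  have hΓ : 0 ≤ Γ := norm_nonneg _
  set R := B + ‖hstar‖ + ‖lamstar‖ with hR
  have hR0 : 0 ≤ R := by positivity
  -- For an inactive index, `lamstar i = 0` and `σ` contains `λ_i |q_i(hstar)|`, so inactive terms
  -- are bounded by multiples of `σ`. Active indices contribute zero to both sums, as `0⁻¹ = 0`.
  set k₁ := ∑ i, ‖gi i‖ * |q i hstar|⁻¹ with hk₁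
  set k₂ := ∑ i, |q i hstar|⁻¹ with hk₂
  have hk₁0 : 0 ≤ k₁ := by positivity
  have hk₂0 : 0 ≤ k₂ := by positivity
  have hk₁' : ∀ i, ‖gi i‖ ≤ k₁ * |q i hstar| := fun i => by
    by_cases hi : q i hstar = 0
    · simp [hgi, hi]
    · have h1 : ‖gi i‖ * |q i hstar|⁻¹ ≤ k₁ :=
        Finset.single_le_sum (f := fun i => ‖gi i‖ * |q i hstar|⁻¹)
          (fun j _ => by positivity) (Finset.mem_univ i)
      have h2 : 0 < |q i hstar| := abs_pos.2 hi
      calc ‖gi i‖ = ‖gi i‖ * |q i hstar|⁻¹ * |q i hstar| := by field_simp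
        _ ≤ _ := mul_le_mul_of_nonneg_right h1 h2.le
  have hk₂' : ∀ i, q i hstar ≠ 0 → 1 ≤ k₂ * |q i hstar| := fun i hi => by
    have h1 : |q i hstar|⁻¹ ≤ k₂ :=
      Finset.single_le_sum (f := fun i => |q i hstar|⁻¹)
          (fun j _ => by positivity) (Finset.mem_univ i)
    have h2 : 0 < |q i hstar| := abs_pos.2 hi
    calc (1 : ℝ) = |q i hstar|⁻¹ * |q i hstar| := by field_simp
      _ ≤ _ := mul_le_mul_of_nonneg_right h1 h2.le
  set D := ‖combination g‖
  have hD : 0 ≤ D := norm_nonneg _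
  set Kw := P + D * R + B with hKw
  have hKw0 : 0 ≤ Kw := by positivity
  set T := ∑ i, B * -q i hstar with hT
  have hT0 : 0 ≤ T := Finset.sum_nonneg fun i _ => mul_nonneg hB (by linarith [hfeas i])
  obtain ⟨K, K1, K2, K3, K4, K5, K6, K6', K7, K8, K9, K10, K11⟩ : ∃ K, 1 ≤ K ∧ R ≤ K ∧ P ≤ K ∧
      T ≤ K ∧ R * (Γ * R) ≤ K ∧ c ≤ K ∧ R * k₂ ≤ K ∧ Γ * R ≤ K ∧ Γ * R * k₁ ≤ K ∧ Γ * Q ≤ K ∧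
      Γ * R + 2 * R ≤ K ∧ Kw ^ 2 + Q ^ 2 + Kw * (Γ * Q) ≤ K := by
    clear_value R k₁ k₂ Kw T Γ D
    have n1 : 0 ≤ R * (Γ * R) := by positivity
    have n2 : 0 ≤ R * k₂ := by positivity
    have n3 : 0 ≤ Γ * R := by positivity
    have n4 : 0 ≤ Γ * R * k₁ := by positivity
    have n5 : 0 ≤ Γ * Q := by positivity
    have n6 : 0 ≤ Kw ^ 2 + Q ^ 2 + Kw * (Γ * Q) := by positivity
    refine ⟨1 + R + P + T + R * (Γ * R) + c + R * k₂ + Γ * R + Γ * R * k₁ + Γ * Q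
      + 2 * R + (Kw ^ 2 + Q ^ 2 + Kw * (Γ * Q)), ?_⟩
    refine ⟨?_, ?_, ?_, ?_, ?_, ?_, ?_, ?_, ?_, ?_, ?_, ?_⟩ <;> linarith
  refine ⟨G, K, K1, fun h lam hh hlam hlam0 hd => ?_⟩
  set d := h - hstar with hddef
  set ν := lam - lamstar with hν
  set p := F h - F hstar with hp
  set σ := ∑ i, lam i * -q i hstar with hσ
  have hσ0 : 0 ≤ σ := Finset.sum_nonneg fun i _ => mul_nonneg (hlam0 i) (by linarith [hfeas i])
  have hdR : ‖d‖ ≤ R := (norm_sub_le _ _).trans (by linarith [norm_nonneg lamstar])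
  have hνR : ‖ν‖ ≤ R := (norm_sub_le _ _).trans (by linarith [norm_nonneg hstar])
  have hlamB : ∀ i, lam i ≤ B := fun i =>
    ((le_abs_self _).trans (PiLp.norm_apply_le lam i)).trans hlam
  have hpP : ‖p‖ ≤ P := hP h hh
  have hGν : ‖G ν‖ ≤ Γ * R :=
    (G.le_opNorm ν).trans (mul_le_mul_of_nonneg_left hνR hΓ)
  have hνi : ∀ i, q i hstar ≠ 0 → ν i = lam i := fun i hi => by
    have := (mul_eq_zero.1 (hcompl i)).resolve_right hi
    simp [hν, this]
  have hGi : ‖combination gi ν‖ ≤ k₁ * σ := by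
    rw [combination_apply, hσ, Finset.mul_sum]
    refine (norm_sum_le _ _).trans (Finset.sum_le_sum fun i _ => ?_)
    rw [norm_smul]
    by_cases hi : q i hstar = 0
    · simp [hgi, hi]
    · have h1 := mul_le_mul_of_nonneg_left (hk₁' i) (hlam0 i)
      rw [abs_of_nonpos (hfeas i)] at h1
      rw [hνi i hi, Real.norm_of_nonneg (hlam0 i)]
      linarith
  refine ⟨hdR.trans K2, hpP.trans K3, hσ0, ?_, ?_, ?_, ?_⟩
  · have : σ ≤ T := Finset.sum_le_sum fun i _ =>
      mul_le_mul_of_nonneg_right (hlamB i) (by linarith [hfeas i])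
    linarith
  · have := (abs_real_inner_le_norm d (G ν)).trans
      (mul_le_mul hdR hGν (norm_nonneg _) hR0)
    linarith
  · set νa : Vec s := WithLp.toLp 2 fun i => if q i hstar = 0 then ν i else 0 with hνa
    have h1 : G ν = combination g νa := by
      rw [hG, combination_apply, combination_apply]
      refine Finset.sum_congr rfl fun i _ => ?_
      by_cases hi : q i hstar = 0 <;> simp [hga, hνa, hi]
    have h2 := hc νa fun i hi => by simp [hνa, hi]
    have h3 : ‖ν‖ ^ 2 ≤ ‖νa‖ ^ 2 + R * k₂ * σ := by
      rw [EuclideanSpace.norm_sq_eq, EuclideanSpace.norm_sq_eq, hσ, Finset.mul_sum,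
        ← Finset.sum_add_distrib]
      refine Finset.sum_le_sum fun i _ => ?_
      by_cases hi : q i hstar = 0
      · simp [hνa, hi]
      · have h4 := hk₂' i hi
        rw [abs_of_nonpos (hfeas i)] at h4
        have h5 : lam i ≤ R := (hlamB i).trans (by
          linarith [norm_nonneg hstar, norm_nonneg lamstar])
        have h6 : lam i * lam i ≤ lam i * R := mul_le_mul_of_nonneg_left h5 (hlam0 i)
        have h7 : lam i * R * 1 ≤ lam i * R * (k₂ * -q i hstar) :=
          mul_le_mul_of_nonneg_left h4 (mul_nonneg (hlam0 i) hR0)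
        have h8 : νa i = 0 := by simp [hνa, hi]
        rw [hνi i hi, h8, Real.norm_of_nonneg (hlam0 i), norm_zero]
        linarith
    rw [← h1] at h2
    have h4 : c * ‖Sᗮ.starProjection (G ν)‖ ^ 2 ≤ K * ‖Sᗮ.starProjection (G ν)‖ ^ 2 :=
      mul_le_mul_of_nonneg_right K6 (by positivity)
    have h5 : R * k₂ * σ ≤ K * σ := mul_le_mul_of_nonneg_right K6' hσ0
    linarith
  · intro β κ γ hβ hκ0 hκ1 hγ
    set w := Sᗮ.starProjection (F h + combination g lam + β) with hwdef
    -- Stationarity places `F hstar + combination g lamstar` in the row space, which the projection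
    -- kills; the equality multiplier thereby disappears.
    have hw : w = Sᗮ.starProjection (p + combination g ν + β) := by
      have h1 : F h + combination g lam + β =
          (p + combination g ν + β) + (F hstar + combination g lamstar) := by
        rw [hp, hν, map_sub]; abel
      have h2 : Sᗮ.starProjection (F hstar + combination g lamstar) = 0 := by
        rw [Submodule.starProjection_apply_eq_zero_iff, Submodule.orthogonal_orthogonal]
        exact hstat
      rw [hwdef, h1, map_add, h2, add_zero]
    have hwK : ‖w‖ ≤ Kw := by
      rw [hw]
      refine (Submodule.norm_starProjection_apply_le _ _).trans (norm_add₃_le.trans ?_)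
      have : ‖combination g ν‖ ≤ D * R :=
        ((combination g).le_opNorm ν).trans (mul_le_mul_of_nonneg_left hνR hD)
      linarith
    have hqvQ := hQ h hh
    set qv := constraintVec q h with hqv
    have hV := dist_sq_step_le S g hd p β (lam := lam) (qv := qv) (qs := constraintVec q hstar)
      hls hcompl (fun i => hq i h hstar) γ hγ w hw
    have hX := cross_step_le S g ga gi hg h hstar p β (lamstar := lamstar) (qv := qv)
      hlam0 γ hγ w hw
    change _ ≤ _ - 2 * γ * (inner ℝ p d + σ) + _ + _ at hV
    rw [← hddef, ← hν] at hV hX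
    exact add_mul_step_le hγ hκ0 hκ1 hσ0 (norm_nonneg _) (norm_nonneg _) (norm_nonneg _)
      (norm_nonneg _) (norm_nonneg _) hΓ hQ0 hR0 (norm_nonneg _) hKw0 hV hX hwK hqvQ hGν hGi hdR
      K7 K8 K9 K10 K11

/-- Strict monotonicity carries no rate by itself; on the compact set of bounded points at distance
at least `ρ` the continuous gap attains a positive minimum. -/
theorem exists_pos_le_monotone_gap {n : ℕ} {F : Vec n → Vec n} (hF : Continuous F)
    (hmono : IsStrictlyMonotone F) (hstar : Vec n) (B : ℝ) {ρ : ℝ} (hρ : 0 < ρ) :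
    ∃ m, 0 < m ∧ ∀ h, ‖h‖ ≤ B → ρ ≤ ‖h - hstar‖ → m ≤ inner ℝ (F h - F hstar) (h - hstar) := by
  set Z := Metric.closedBall (0 : Vec n) B ∩ {h | ρ ≤ ‖h - hstar‖} with hZ
  have hcomp : IsCompact Z := (isCompact_closedBall _ _).inter_right
    (isClosed_le continuous_const (by fun_prop))
  have hcont : Continuous fun h => inner ℝ (F h - F hstar) (h - hstar) := by fun_prop
  have hmem : ∀ h, ‖h‖ ≤ B → ρ ≤ ‖h - hstar‖ → h ∈ Z := fun h h1 h2 => ⟨by simpa using h1, h2⟩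
  rcases Z.eq_empty_or_nonempty with he | hne
  · exact ⟨1, one_pos, fun h h1 h2 => absurd (hmem h h1 h2) (by simp [he])⟩
  · obtain ⟨x, hx, hmin⟩ := hcomp.exists_isMinOn hne hcont.continuousOn
    refine ⟨_, hmono x hstar ?_, fun h h1 h2 => hmin (hmem h h1 h2)⟩
    rintro rfl
    have : ρ ≤ ‖x - x‖ := hx.2
    simp at this
    linarith

set_option maxHeartbeats 1000000 in
/-- A Lyapunov function for the perturbed primal-dual iteration on a bounded set. -/
theorem exists_lyapunov {n s : ℕ} {F : Vec n → Vec n} (hF : Continuous F)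
    (hmono : IsStrictlyMonotone F)
    (S : Submodule ℝ (Vec n)) (g : Fin s → Vec n) (q : Fin s → Vec n → ℝ)
    (hq : ∀ i x y, q i x - q i y = inner ℝ (g i) (x - y)) (hstar : Vec n) (lamstar : Vec s)
    (hls : ∀ i, 0 ≤ lamstar i) (hfeas : ∀ i, q i hstar ≤ 0)
    (hcompl : ∀ i, lamstar i * q i hstar = 0)
    (hstat : F hstar + combination g lamstar ∈ S)
    (hlicq : ∃ c, 0 ≤ c ∧ ∀ v : Vec s, (∀ i, q i hstar ≠ 0 → v i = 0) →
      ‖v‖ ^ 2 ≤ c * ‖Sᗮ.starProjection (combination g v)‖ ^ 2) (B : ℝ) (hB : 0 ≤ B)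
    {ε : ℝ} (hε : 0 < ε) :
    ∃ (W : Vec n → Vec s → ℝ) (c θ η K : ℝ), 0 < θ ∧ 0 < η ∧ 0 < K ∧
      ∀ (h : Vec n) (lam : Vec s), ‖h‖ ≤ B → ‖lam‖ ≤ B → (∀ i, 0 ≤ lam i) → h - hstar ∈ Sᗮ →
        (W h lam ≤ c + η → ‖h - hstar‖ ≤ ε) ∧
        ∀ (β : Vec n) (γ : ℝ), ‖β‖ ≤ B → 0 ≤ γ → γ ≤ 1 →
          W (h - γ • Sᗮ.starProjection (F h + combination g lam + β))
              (dualStep lam γ (constraintVec q h)) ≤ W h lam + K * γ ∧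
          (c ≤ W h lam →
            W (h - γ • Sᗮ.starProjection (F h + combination g lam + β))
                (dualStep lam γ (constraintVec q h)) ≤
              W h lam - γ * θ + γ * K * ‖β‖ + K * γ ^ 2) := by
  obtain ⟨G, K, hK, hstep⟩ := exists_lyapunov_step_bound hF S g q hq hstar lamstar hls hfeas
    hcompl hstat hlicq B hB
  have hK0 : 0 < K := by linarith
  set e := ε ^ 2 with he
  have he0 : 0 < e := by positivity
  obtain ⟨ρ, hρ, hρle⟩ : ∃ ρ > 0, ∀ h, ‖h - hstar‖ < ρ →
      ‖h - hstar‖ ^ 2 ≤ e / 4 ∧ K * (‖F h - F hstar‖ + ‖h - hstar‖) ≤ e / (8 * K) := by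
    have c1 : Tendsto (fun h => ‖h - hstar‖ ^ 2) (𝓝 hstar) (𝓝 0) := by
      have : Continuous fun h => ‖h - hstar‖ ^ 2 := by fun_prop
      simpa using this.tendsto hstar
    have c2 : Tendsto (fun h => K * (‖F h - F hstar‖ + ‖h - hstar‖)) (𝓝 hstar) (𝓝 0) := by
      have : Continuous fun h => K * (‖F h - F hstar‖ + ‖h - hstar‖) := by fun_prop
      simpa using this.tendsto hstar
    have := (c1.eventually_lt_const (by positivity : 0 < e / 4)).and
      (c2.eventually_lt_const (by positivity : 0 < e / (8 * K)))
    obtain ⟨ρ, hρ, hb⟩ := Metric.eventually_nhds_iff.1 this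
    refine ⟨ρ, hρ, fun h hh => ?_⟩
    rw [← dist_eq_norm] at hh
    exact ⟨(hb hh).1.le, (hb hh).2.le⟩
  obtain ⟨m, hm, hgap⟩ := exists_pos_le_monotone_gap hF hmono hstar B hρ
  -- The three smallness conditions make, in turn, the cross-term error at most `σ`, its remaining
  -- part at most the gap `m` away from `hstar`, and the cross term in `W` at most `e / 8`.
  obtain ⟨κ, hκ0, hκ1, hκ2, hκ3⟩ : ∃ κ, 0 < κ ∧ κ * K ≤ 1 ∧ κ * K * (2 * K) ≤ m ∧
      κ * K ≤ e / 8 := by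
    refine ⟨min (1 / K) (min (m / (2 * K ^ 2)) (e / (8 * K))), by positivity, ?_, ?_, ?_⟩
    · rw [← le_div_iff₀ hK0]; exact min_le_left _ _
    · rw [mul_assoc, ← le_div_iff₀ (by positivity)]
      refine (min_le_right _ _).trans ((min_le_left _ _).trans_eq ?_)
      congr 1; ring
    · rw [← le_div_iff₀ hK0, div_div]
      exact (min_le_right _ _).trans (min_le_right _ _)
  have hκ1' : κ ≤ 1 := by nlinarith
  -- The cross term shifts `W` by at most `κ * K`. So `W ≥ c` gives squared distance at least `e /
  -- 2`, and `W ≤ c + η` gives at most `e / 2 + e / 4 + 2 κ K ≤ e`.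
  refine ⟨lyapunov G hstar lamstar κ, e / 2 + κ * K, min (κ * (e / (8 * K))) m, e / 4,
    3 * K ^ 2 + K * B + K, by positivity, by positivity, by positivity,
    fun h lam hh hlam hlam0 hd => ?_⟩
  obtain ⟨b1, b2, b3, b4, b5, b6, b7⟩ := hstep h lam hh hlam hlam0 hd
  set d := ‖h - hstar‖
  set p := ‖F h - F hstar‖
  set σ := ∑ i, lam i * -q i hstar
  set ℓ := ‖Sᗮ.starProjection (G (lam - lamstar))‖ ^ 2 with hℓ
  set φ : ℝ := inner ℝ (F h - F hstar) (h - hstar) with hφ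
  have hℓ0 : 0 ≤ ℓ := by positivity
  have hd0 : 0 ≤ d := norm_nonneg _
  have hp0 : 0 ≤ p := norm_nonneg _
  have hφ0 : 0 ≤ φ := by
    by_cases hhs : h = hstar
    · simp [hφ, hhs]
    · exact (hmono h hstar hhs).le
  have hWV : |lyapunov G hstar lamstar κ h lam - (d ^ 2 + ‖lam - lamstar‖ ^ 2)| ≤ κ * K := by
    unfold lyapunov
    rw [add_sub_cancel_left, abs_mul, abs_of_pos hκ0]
    exact mul_le_mul_of_nonneg_left b5 hκ0.le
  obtain ⟨w1, w2⟩ := abs_le.1 hWV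
  refine ⟨fun hW => ?_, fun β γ hβ hγ0 hγ1 => ?_⟩
  · rw [← sq_le_sq₀ hd0 hε.le]
    nlinarith [sq_nonneg ‖lam - lamstar‖]
  · have step := b7 β κ γ hβ hκ0.le hκ1' hγ0
    set Ψ := 2 * φ + 2 * σ + κ * ℓ - κ * K * (p + σ + d) with hΨ
    have k1 : 0 ≤ K * B := by positivity
    have k2 : 0 ≤ K ^ 2 := by positivity
    have hγ2 : γ ^ 2 ≤ γ := by nlinarith
    constructor
    · have h1 : -(3 * K ^ 2) ≤ Ψ := by
        have t1 : κ * K * (p + σ + d) ≤ 1 * (p + σ + d) := by gcongr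
        have t2 : 0 ≤ κ * ℓ := by positivity
        nlinarith
      have h2 := mul_le_mul_of_nonneg_left h1 hγ0
      have h3 : γ * K * ‖β‖ ≤ γ * K * B := by gcongr
      have h4 : K * γ ^ 2 ≤ K * γ := by gcongr
      linarith
    · intro hcW
      have hV : e / 2 ≤ d ^ 2 + ‖lam - lamstar‖ ^ 2 := by linarith
      have h1 : min (κ * (e / (8 * K))) m ≤ Ψ := by
        have t3 : κ * K * σ ≤ 1 * σ := by gcongr
        -- Near `hstar` the multiplier error must carry at least `e / 4`, so `ℓ + σ ≥ e / (4 K)` and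
        -- half of this survives the errors. Far from it the gap `m` alone suffices.
        rcases lt_or_ge d ρ with hdρ | hdρ
        · refine (min_le_left _ _).trans ?_
          obtain ⟨r1, r2⟩ := hρle h hdρ
          have t1 : e / 4 ≤ K * (ℓ + σ) := by linarith
          have t2 : e / (4 * K) ≤ ℓ + σ := by
            rw [div_le_iff₀ (by positivity)]; linarith
          have t4 : κ * σ ≤ 1 * σ := by gcongr
          have t5 := mul_le_mul_of_nonneg_left t2 hκ0.le
          have t6 := mul_le_mul_of_nonneg_left r2 hκ0.le
          have t7 : e / (4 * K) = 2 * (e / (8 * K)) := by field_simp; norm_num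
          rw [t7] at t5
          linarith
        · refine (min_le_right _ _).trans ?_
          have t1 := hgap h hh hdρ
          have t2 : 0 ≤ κ * ℓ := by positivity
          have t4 : κ * K * (p + d) ≤ κ * K * (2 * K) := by gcongr; linarith
          linarith
      have h2 := mul_le_mul_of_nonneg_left h1 hγ0
      have h3 : γ * K * ‖β‖ ≤ γ * (3 * K ^ 2 + K * B + K) * ‖β‖ := by gcongr; linarith
      have h4 : K * γ ^ 2 ≤ (3 * K ^ 2 + K * B + K) * γ ^ 2 := by gcongr; linarith
      linarith

/-! ### The projection `L`, affine constraints and LICQ. -/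

theorem subspaceProj_eq_starProjection {n l : ℕ} {A : Matrix (Fin l) (Fin n) ℝ}
    {u : OrthonormalBasis (Fin n) ℝ (Vec n)} {M : ℕ} (hu : SpansRows A u M) (v : Vec n) :
    subspaceProj u M v = (Submodule.span ℝ (range (rowVec A)))ᗮ.starProjection v := by
  rw [← hu.2]
  symm
  refine Submodule.eq_starProjection_of_mem_of_inner_eq_zero ?_ ?_
  · rw [Submodule.mem_orthogonal]
    intro x hx
    induction hx using Submodule.span_induction with
    | mem x hx =>
      obtain ⟨j, hj, rfl⟩ := hx
      have hj' : j.val < M := hj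
      rw [subspaceProj, inner_sub_right, inner_sum]
      simp [inner_smul_right, u.inner_eq_ite, hj']
    | zero => simp
    | add x y _ _ hx hy => rw [inner_add_left, hx, hy, add_zero]
    | smul a x _ hx => rw [inner_smul_left, hx, mul_zero]
  · intro w hw
    rw [subspaceProj, sub_sub_cancel, sum_inner]
    refine Finset.sum_eq_zero fun i hi => ?_
    have : inner ℝ (u i) w = 0 := (Submodule.mem_orthogonal _ _).1 hw _
      (Submodule.subset_span ⟨i, (Finset.mem_filter.1 hi).2, rfl⟩)
    rw [inner_smul_left, this, mul_zero]

theorem inner_rowVec {n l : ℕ} (A : Matrix (Fin l) (Fin n) ℝ) (j : Fin l) (v : Vec n) :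
    inner ℝ (rowVec A j) v = (A *ᵥ v.ofLp) j := by
  simp [rowVec, PiLp.inner_apply, Matrix.mulVec, dotProduct, mul_comm]

theorem mem_orthogonal_rows_iff {n l : ℕ} (A : Matrix (Fin l) (Fin n) ℝ) (v : Vec n) :
    v ∈ (Submodule.span ℝ (range (rowVec A)))ᗮ ↔ A *ᵥ v.ofLp = 0 := by
  rw [Submodule.mem_orthogonal]
  constructor
  · intro h
    ext j
    rw [← inner_rowVec]
    exact h _ (Submodule.subset_span ⟨j, rfl⟩)
  · intro h x hx
    induction hx using Submodule.span_induction with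
    | mem x hx =>
      obtain ⟨j, rfl⟩ := hx
      rw [inner_rowVec, h]; rfl
    | zero => simp
    | add x y _ _ hx hy => rw [inner_add_left, hx, hy, add_zero]
    | smul a x _ hx => rw [inner_smul_left, hx, mul_zero]

theorem transpose_mulVec_mem_span_rows {n l : ℕ} (A : Matrix (Fin l) (Fin n) ℝ) (v : Fin l → ℝ) :
    WithLp.toLp 2 (Aᵀ *ᵥ v) ∈ Submodule.span ℝ (range (rowVec A)) := by
  have : WithLp.toLp 2 (Aᵀ *ᵥ v) = ∑ j, v j • rowVec A j := by
    ext i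
    simp [rowVec, Matrix.mulVec, dotProduct, Matrix.transpose_apply, mul_comm]
  rw [this]
  exact Submodule.sum_mem _ fun j _ => Submodule.smul_mem _ _ (Submodule.subset_span ⟨j, rfl⟩)

/-- An affine function has a constant gradient, which computes its increments. -/
theorem affine_sub_eq_inner_gradient {n : ℕ} (f : Vec n →ᵃ[ℝ] ℝ) (z x y : Vec n) :
    f x - f y = inner ℝ (gradient f z) (x - y) := by
  have hlin : ∀ x, HasFDerivAt f (LinearMap.toContinuousLinearMap f.linear) x := fun x => by
    have h1 : (f : Vec n → ℝ) = fun x => LinearMap.toContinuousLinearMap f.linear x + f 0 := by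
      ext x; simpa using congrFun (AffineMap.decomp f) x
    rw [h1]
    exact (ContinuousLinearMap.hasFDerivAt _).add_const _
  have h2 : inner ℝ (gradient f z) (x - y) = fderiv ℝ f z (x - y) := by
    simp [gradient]
  rw [h2, (hlin z).fderiv]
  have := f.linearMap_vsub x y
  simpa using this.symm

theorem gradient_affine_eq {n : ℕ} (f : Vec n →ᵃ[ℝ] ℝ) (x y : Vec n) :
    gradient f x = gradient f y := by
  refine ext_inner_right ℝ fun v => ?_
  have h1 := affine_sub_eq_inner_gradient f x v 0
  have h2 := affine_sub_eq_inner_gradient f y v 0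
  rw [sub_zero] at h1 h2
  rw [← h1, ← h2]

/-- Under LICQ the active gradients stay independent modulo the row space, so `v ↦ L ∑ v_i ∇q^i` is
injective on vectors supported on the active indices; in finite dimension it is then bounded below.
-/
theorem LICQ.exists_bound {n l s : ℕ} {A : Matrix (Fin l) (Fin n) ℝ} {q : Fin s → Vec n → ℝ}
    {h : Vec n} (hl : LICQ A q h) :
    ∃ c, 0 ≤ c ∧ ∀ v : Vec s, (∀ i, q i h ≠ 0 → v i = 0) →
      ‖v‖ ^ 2 ≤ c * ‖(Submodule.span ℝ (range (rowVec A)))ᗮ.starProjection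
        (combination (fun i => gradient (q i) h) v)‖ ^ 2 := by
  classical
  set S := Submodule.span ℝ (range (rowVec A)) with hS
  set g := fun i => gradient (q i) h with hg
  obtain ⟨hl1, -, hl3⟩ := linearIndependent_sum.1 hl
  rw [Sum.elim_comp_inl] at hl1
  rw [Sum.elim_comp_inl, Sum.elim_comp_inr, ← hS] at hl3
  let V : Submodule ℝ (Vec s) :=
    { carrier := {v | ∀ i, q i h ≠ 0 → v i = 0}
      add_mem' := fun {a b} ha hb i hi => by simp [ha i hi, hb i hi]
      zero_mem' := fun i _ => rfl
      smul_mem' := fun c x hx i hi => by simp [hx i hi] }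
  let T : V →ₗ[ℝ] Vec n := (Sᗮ.starProjection ∘L combination g).toLinearMap ∘ₗ V.subtype
  have hinj : LinearMap.ker T = ⊥ := by
    rw [LinearMap.ker_eq_bot']
    rintro ⟨v, hv⟩ hTv
    have h1 : Sᗮ.starProjection (combination g v) = 0 := hTv
    rw [Submodule.starProjection_apply_eq_zero_iff, Submodule.orthogonal_orthogonal] at h1
    have h2 : combination g v = ∑ i : {i : Fin s // q i h = 0}, v i • gradient (q i) h := by
      rw [combination_apply, ← Finset.sum_subtype (Finset.univ.filter fun i => q i h = 0)
        (by simp) (fun i => v i • gradient (q i) h)]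
      refine (Finset.sum_filter_of_ne fun i _ hi => ?_).symm
      by_contra hqi
      exact hi (by rw [hv i hqi, zero_smul])
    have h3 : combination g v = 0 := by
      refine (Submodule.disjoint_def.1 hl3) _ ?_ h1
      rw [h2]
      exact Submodule.sum_mem _ fun j _ =>
        Submodule.smul_mem _ _ (Submodule.subset_span ⟨j, rfl⟩)
    rw [h2] at h3
    have h4 := Fintype.linearIndependent_iff.1 hl1 _ h3
    ext i
    by_cases hi : q i h = 0
    · exact h4 ⟨i, hi⟩
    · exact hv i hi
  obtain ⟨K, -, hK⟩ := T.exists_antilipschitzWith hinj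
  refine ⟨(K : ℝ) ^ 2, by positivity, fun v hv => ?_⟩
  have h1 : ‖v‖ ≤ K * ‖Sᗮ.starProjection (combination g v)‖ := by
    have := hK.le_mul_dist ⟨v, hv⟩ 0
    rw [map_zero, dist_zero_right, dist_zero_right] at this
    exact this
  rw [← mul_pow]
  gcongr

/-! ### The empirical CVaR -/

/-- `η + (N α)⁻¹ ∑_{j < N} [z j - η]⁺`. -/
noncomputable def empObjective (α : ℝ) (N : ℕ) (z : ℕ → ℝ) (η : ℝ) : ℝ :=
  η + ((N : ℝ) * α)⁻¹ * ∑ j ∈ Finset.range N, max (z j - η) 0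

/-- Since `α⁻¹ ≥ 1`, `η + α⁻¹ [t - η]⁺ ≥ t`. This gives both the finiteness of the infimum and its
comparison with the smallest sample. -/
theorem le_empObjective {α : ℝ} (hα₀ : 0 < α) (hα₁ : α ≤ 1) {N : ℕ} (hN : 0 < N) {z : ℕ → ℝ}
    {t : ℝ} (hz : ∀ j < N, t ≤ z j) (η : ℝ) : t ≤ empObjective α N z η := by
  have hN' : (0 : ℝ) < N := by exact_mod_cast hN
  have h1 : N * max (t - η) 0 ≤ ∑ j ∈ Finset.range N, max (z j - η) 0 := by
    rw [← nsmul_eq_mul]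
    nth_rewrite 1 [← Finset.card_range N]
    refine Finset.card_nsmul_le_sum _ _ _ fun j hj => ?_
    exact max_le_max_right _ (by linarith [hz j (Finset.mem_range.1 hj)])
  have h2 := mul_le_mul_of_nonneg_left h1 (by positivity : 0 ≤ ((N : ℝ) * α)⁻¹)
  have h3 : ((N : ℝ) * α)⁻¹ * (N * max (t - η) 0) = α⁻¹ * max (t - η) 0 := by
    field_simp
  have h4 : 1 * max (t - η) 0 ≤ α⁻¹ * max (t - η) 0 :=
    mul_le_mul_of_nonneg_right ((one_le_inv₀ hα₀).2 hα₁) (le_max_right _ _)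
  unfold empObjective
  linarith [le_max_left (t - η) 0]

theorem bddBelow_range_empObjective {α : ℝ} (hα₀ : 0 < α) (hα₁ : α ≤ 1) {N : ℕ} (hN : 0 < N)
    (z : ℕ → ℝ) : BddBelow (range (empObjective α N z)) := by
  obtain ⟨j₀, -, hj₀⟩ := Finset.exists_min_image (Finset.range N) z ⟨0, by simpa using hN⟩
  refine ⟨z j₀, ?_⟩
  rintro _ ⟨η, rfl⟩
  exact le_empObjective hα₀ hα₁ hN (fun j hj => hj₀ j (Finset.mem_range.2 hj)) η

theorem lt_empCVaR {α : ℝ} (hα₀ : 0 < α) (hα₁ : α ≤ 1) {N : ℕ} (hN : 0 < N) {z : ℕ → ℝ}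
    {t : ℝ} (hz : ∀ j < N, t < z j) : t < empCVaR α N z := by
  obtain ⟨j₀, hj₀N, hj₀⟩ := Finset.exists_min_image (Finset.range N) z ⟨0, by simpa using hN⟩
  refine (hz j₀ (Finset.mem_range.1 hj₀N)).trans_le (le_ciInf fun η => ?_)
  exact le_empObjective hα₀ hα₁ hN (fun j hj => hj₀ j (Finset.mem_range.2 hj)) η

theorem empCVaR_lt {α : ℝ} (hα₀ : 0 < α) (hα₁ : α ≤ 1) {N : ℕ} (hN : 0 < N) {z : ℕ → ℝ}
    {t : ℝ} (hz : ∀ j < N, z j < t) : empCVaR α N z < t := by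
  obtain ⟨j₀, hj₀N, hj₀⟩ := Finset.exists_max_image (Finset.range N) z ⟨0, by simpa using hN⟩
  refine (ciInf_le (bddBelow_range_empObjective hα₀ hα₁ hN z) (z j₀)).trans_lt ?_
  refine lt_of_eq_of_lt ?_ (hz j₀ (Finset.mem_range.1 hj₀N))
  rw [empObjective, Finset.sum_eq_zero fun j hj => max_eq_right (by linarith [hj₀ j hj])]
  ring

/-- An infimum of continuous functions is upper semicontinuous, which disposes of the uncountable
infimum. -/
theorem measurable_empCVaR {α : ℝ} (hα₀ : 0 < α) (hα₁ : α ≤ 1) {N : ℕ} (hN : 0 < N) :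
    Measurable (empCVaR α N) := by
  refine measurable_of_Ici fun t => IsClosed.measurableSet ?_
  have : empCVaR α N ⁻¹' Ici t = ⋂ η, {z | t ≤ empObjective α N z η} := by
    ext z
    simp only [mem_preimage, mem_Ici, mem_iInter, mem_ofPred_eq]
    exact le_ciInf_iff (bddBelow_range_empObjective hα₀ hα₁ hN z)
  rw [this]
  refine isClosed_iInter fun η => isClosed_le continuous_const ?_
  unfold empObjective
  fun_prop

/-! ### Comparison of infima on a grid -/

/-- Rounding up to a grid changes `η + κ g(η)` by at most the mesh `δ`. -/
theorem exists_grid_le {κ : ℝ} (hκ : 1 ≤ κ) {g : ℝ → ℝ} (hg : Antitone g) (hg0 : ∀ η, 0 ≤ g η)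
    {a δ : ℝ} (hδ : 0 < δ) {J : ℕ} (hga : ∀ η ≤ a, g η = g a + (a - η))
    (hgb : g (a + J * δ) = 0) (η : ℝ) :
    -- Left of `a` the objective has slope `1 - κ ≤ 0`, so `a` is at least as good. Right of the
    -- last grid point `g` vanishes and the objective is at least `η`. In between, rounding up
    -- increases `η` by at most `δ` and cannot increase `g`.
    ∃ j ∈ Finset.range (J + 1), a + j * δ + κ * g (a + j * δ) ≤ η + κ * g η + δ := by
  have hκ0 : 0 ≤ κ := by linarith
  rcases le_or_gt η a with h1 | h1
  · refine ⟨0, by simp, ?_⟩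
    have := hga η h1
    rw [this]
    simp only [Nat.cast_zero, zero_mul, add_zero]
    nlinarith
  · rcases le_or_gt η (a + J * δ) with h2 | h2
    · refine ⟨⌈(η - a) / δ⌉₊, ?_, ?_⟩
      · rw [Finset.mem_range, Nat.lt_succ_iff, Nat.ceil_le, div_le_iff₀ hδ]; linarith
      · have e1 := Nat.le_ceil ((η - a) / δ)
        have e2 := Nat.ceil_lt_add_one (div_nonneg (by linarith : 0 ≤ η - a) hδ.le)
        rw [div_le_iff₀ hδ] at e1
        rw [← sub_lt_iff_lt_add, lt_div_iff₀ hδ] at e2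
        have e3 := mul_le_mul_of_nonneg_left (hg (by linarith :
          η ≤ a + ⌈(η - a) / δ⌉₊ * δ)) hκ0
        linarith
    · refine ⟨J, by simp, ?_⟩
      rw [hgb]
      have := mul_nonneg hκ0 (hg0 η)
      linarith

theorem iInf_le_iInf_add_grid {κ : ℝ} (hκ : 1 ≤ κ) {g₁ g₂ : ℝ → ℝ} (h₁ : Antitone g₁)
    (h₂ : Antitone g₂) (h₁0 : ∀ η, 0 ≤ g₁ η) (h₂0 : ∀ η, 0 ≤ g₂ η) {a δ : ℝ} (hδ : 0 < δ) {J : ℕ}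
    (h₁a : ∀ η ≤ a, g₁ η = g₁ a + (a - η)) (h₂a : ∀ η ≤ a, g₂ η = g₂ a + (a - η))
    (h₁b : g₁ (a + J * δ) = 0) (h₂b : g₂ (a + J * δ) = 0) :
    ⨅ η, (η + κ * g₁ η) ≤ (⨅ η, (η + κ * g₂ η)) + (δ + κ * ∑ j ∈ Finset.range (J + 1),
      |g₁ (a + j * δ) - g₂ (a + j * δ)|) := by
  have hκ0 : 0 ≤ κ := by linarith
  have hbdd : BddBelow (range fun η => η + κ * g₁ η) := by
    refine ⟨a - δ, ?_⟩
    rintro _ ⟨η, rfl⟩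
    obtain ⟨j, -, hj⟩ := exists_grid_le hκ h₁ h₁0 hδ h₁a h₁b η
    have := mul_nonneg hκ0 (h₁0 (a + j * δ))
    have : 0 ≤ j * δ := by positivity
    linarith
  rw [← sub_le_iff_le_add]
  refine le_ciInf fun η => ?_
  obtain ⟨j, hj, hle⟩ := exists_grid_le hκ h₂ h₂0 hδ h₂a h₂b η
  have e1 := ciInf_le hbdd (a + j * δ)
  have e2 := Finset.single_le_sum (f := fun j : ℕ => |g₁ (a + j * δ) - g₂ (a + j * δ)|)
    (fun j _ => abs_nonneg _) hj
  have e3 := (le_abs_self _).trans e2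
  have e4 := mul_le_mul_of_nonneg_left e3 hκ0
  linarith

theorem abs_iInf_sub_iInf_le_grid {κ : ℝ} (hκ : 1 ≤ κ) {g₁ g₂ : ℝ → ℝ} (h₁ : Antitone g₁)
    (h₂ : Antitone g₂) (h₁0 : ∀ η, 0 ≤ g₁ η) (h₂0 : ∀ η, 0 ≤ g₂ η) {a δ : ℝ} (hδ : 0 < δ) {J : ℕ}
    (h₁a : ∀ η ≤ a, g₁ η = g₁ a + (a - η)) (h₂a : ∀ η ≤ a, g₂ η = g₂ a + (a - η))
    (h₁b : g₁ (a + J * δ) = 0) (h₂b : g₂ (a + J * δ) = 0) :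
    |(⨅ η, (η + κ * g₁ η)) - ⨅ η, (η + κ * g₂ η)| ≤ δ + κ * ∑ j ∈ Finset.range (J + 1),
      |g₁ (a + j * δ) - g₂ (a + j * δ)| := by
  have e1 := iInf_le_iInf_add_grid hκ h₁ h₂ h₁0 h₂0 hδ h₁a h₂a h₁b h₂b
  have e2 := iInf_le_iInf_add_grid hκ h₂ h₁ h₂0 h₁0 hδ h₂a h₁a h₂b h₁b
  simp_rw [abs_sub_comm (g₂ _)] at e2
  exact abs_le.2 ⟨by linarith, by linarith⟩

/-- The integrated excess `η ↦ ∫ [Z - η]⁺` of a bounded variable satisfies the hypotheses of the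
grid comparison. -/
theorem excess_properties {X : Type*} [MeasurableSpace X] {P : Measure X} [IsProbabilityMeasure P]
    {Z : X → ℝ} (hZ : Measurable Z) {a b : ℝ} (hab : ∀ᵐ x ∂P, Z x ∈ Icc a b) :
    let g := fun η => ∫ x, max (Z x - η) 0 ∂P
    Antitone g ∧ (∀ η, 0 ≤ g η) ∧ (∀ η ≤ a, g η = g a + (a - η)) ∧ g b = 0 := by
  have hZi : Integrable Z P := (memLp_of_bounded hab hZ.aestronglyMeasurable 1).integrable le_rfl
  have hint : ∀ η, Integrable (fun x => max (Z x - η) 0) P := fun η =>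
    (hZi.sub (integrable_const η)).pos_part
  refine ⟨fun η₁ η₂ h => ?_, fun η => integral_nonneg fun x => le_max_right _ _,
    fun η hη => ?_, ?_⟩
  · exact integral_mono (hint _) (hint _) fun x => max_le_max_right _ (by linarith)
  · have e : ∀ η ≤ a, ∫ x, max (Z x - η) 0 ∂P = ∫ x, Z x ∂P - η := fun η hη => by
      rw [integral_congr_ae (g := fun x => Z x - η), integral_sub hZi (integrable_const η)]
      · simp
      · filter_upwards [hab] with x hx
        exact max_eq_left (by linarith [hx.1])
    simp only [e η hη, e a le_rfl]; ring
  · refine integral_eq_zero_of_ae ?_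
    filter_upwards [hab] with x hx
    exact max_eq_right (by linarith [hx.2])

theorem empExcess_properties {N : ℕ} (hN : 0 < N) {z : ℕ → ℝ} {a b : ℝ}
    (hab : ∀ j < N, z j ∈ Icc a b) :
    let g := fun η => (N : ℝ)⁻¹ * ∑ j ∈ Finset.range N, max (z j - η) 0
    Antitone g ∧ (∀ η, 0 ≤ g η) ∧ (∀ η ≤ a, g η = g a + (a - η)) ∧ g b = 0 := by
  have hN' : (0 : ℝ) < N := by exact_mod_cast hN
  refine ⟨fun η₁ η₂ h => ?_, fun η => ?_, fun η hη => ?_, ?_⟩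
  · exact mul_le_mul_of_nonneg_left
      (Finset.sum_le_sum fun j _ => max_le_max_right _ (by linarith)) (by positivity)
  · exact mul_nonneg (by positivity) (Finset.sum_nonneg fun j _ => le_max_right _ _)
  · have e : ∀ η ≤ a, ∑ j ∈ Finset.range N, max (z j - η) 0 =
        ∑ j ∈ Finset.range N, z j - N * η := fun η hη => by
      rw [Finset.sum_congr rfl fun j hj => max_eq_left (a := z j - η) (b := 0)
        (by linarith [(hab j (Finset.mem_range.1 hj)).1])]
      simp [Finset.sum_sub_distrib]
    simp only [e η hη, e a le_rfl]
    field_simp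
    ring
  · simp only
    rw [Finset.sum_eq_zero fun j hj => max_eq_right
      (by linarith [(hab j (Finset.mem_range.1 hj)).2]), mul_zero]

-- Expected error of the empirical CVaR.

universe u v

section Sampling

variable {X : Type v} [MeasurableSpace X] {P : Measure X} {Ω : Type u} [MeasurableSpace Ω]
  {μ : Measure Ω}

/-- If almost surely some sample misses `D`, then `D` is a null set. -/
theorem measure_eq_zero_of_ae_exists_notMem {ξ : ℕ → Ω → X} (hξ : ∀ j, Measurable (ξ j))
    (hlaw : ∀ j, μ.map (ξ j) = P) (hind : iIndepFun ξ μ) {N : ℕ} {D : Set X}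
    (hD : MeasurableSet D) (h : ∀ᵐ ω ∂μ, ¬ ∀ j < N, ξ j ω ∈ D) : P D = 0 := by
  have h1 := hind.measure_inter_preimage_eq_mul (Finset.range N) (sets := fun _ => D)
    (fun _ _ => hD)
  have h2 : ∀ j, μ (ξ j ⁻¹' D) = P D := fun j => by
    rw [← hlaw j, Measure.map_apply (hξ j) hD]
  simp only [h2, Finset.prod_const, Finset.card_range] at h1
  have h3 : μ (⋂ i ∈ Finset.range N, ξ i ⁻¹' D) = 0 := by
    rw [ae_iff] at h
    convert h using 2
    ext ω
    simp
  rw [h3] at h1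
  exact eq_zero_of_pow_eq_zero h1.symm

/-- An almost sure bound on the empirical CVaR forces the same bound on the sampled variable. -/
theorem ae_mem_Icc_of_empCVaR_bound {α : ℝ} (hα₀ : 0 < α) (hα₁ : α ≤ 1) {ξ : ℕ → Ω → X}
    (hξ : ∀ j, Measurable (ξ j)) (hlaw : ∀ j, μ.map (ξ j) = P) (hind : iIndepFun ξ μ) {N : ℕ}
    (hN : 0 < N) {Z : X → ℝ} (hZ : Measurable Z) {c B : ℝ}
    (h : ∀ᵐ ω ∂μ, |empCVaR α N (fun j => Z (ξ j ω)) - c| ≤ B) :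
    ∀ᵐ x ∂P, Z x ∈ Icc (c - B) (c + B) := by
  have h1 : P {x | c + B < Z x} = 0 := by
    refine measure_eq_zero_of_ae_exists_notMem hξ hlaw hind (N := N)
      (measurableSet_lt measurable_const hZ) ?_
    filter_upwards [h] with ω hω hall
    have := lt_empCVaR hα₀ hα₁ hN (z := fun j => Z (ξ j ω)) hall
    linarith [(abs_le.1 hω).2]
  have h2 : P {x | Z x < c - B} = 0 := by
    refine measure_eq_zero_of_ae_exists_notMem hξ hlaw hind (N := N)
      (measurableSet_lt hZ measurable_const) ?_
    filter_upwards [h] with ω hω hall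
    have := empCVaR_lt hα₀ hα₁ hN (z := fun j => Z (ξ j ω)) hall
    linarith [(abs_le.1 hω).1]
  have h1' : ∀ᵐ x ∂P, ¬ c + B < Z x := measure_eq_zero_iff_ae_notMem.1 h1
  have h2' : ∀ᵐ x ∂P, ¬ Z x < c - B := measure_eq_zero_iff_ae_notMem.1 h2
  filter_upwards [h1', h2'] with x e1 e2
  exact ⟨not_lt.1 e2, not_lt.1 e1⟩

/-- Pointwise `|y| ≤ r + y² / r`, and pairwise independence bounds the variance of the mean by `D² /
N`. -/
theorem integral_abs_mean_sub_le [IsProbabilityMeasure μ] {Y : ℕ → Ω → ℝ} (hY : ∀ j, Measurable (Y j))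
    (hind : Pairwise fun i j => IndepFun (Y i) (Y j) μ) {D m : ℝ}
    (hD : ∀ j, ∀ᵐ ω ∂μ, Y j ω ∈ Icc 0 D) (hm : ∀ j, ∫ ω, Y j ω ∂μ = m) {N : ℕ} (hN : 0 < N)
    {r : ℝ} (hr : 0 < r) :
    Integrable (fun ω => (N : ℝ)⁻¹ * ∑ j ∈ Finset.range N, Y j ω - m) μ ∧
    ∫ ω, |(N : ℝ)⁻¹ * ∑ j ∈ Finset.range N, Y j ω - m| ∂μ ≤ r + D ^ 2 / (N * r) := by
  have hN' : (0 : ℝ) < N := by exact_mod_cast hN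
  have hL2 : ∀ j, MemLp (Y j) 2 μ := fun j =>
    memLp_of_bounded (hD j) (hY j).aestronglyMeasurable 2
  have hsum : MemLp (fun ω => (N : ℝ)⁻¹ * ∑ j ∈ Finset.range N, Y j ω) 2 μ :=
    (memLp_finsetSum (Finset.range N) fun j _ => hL2 j).const_mul _
  have hdev : MemLp (fun ω => (N : ℝ)⁻¹ * ∑ j ∈ Finset.range N, Y j ω - m) 2 μ :=
    hsum.sub (memLp_const (μ := μ) m)
  have hmean : ∫ ω, (N : ℝ)⁻¹ * ∑ j ∈ Finset.range N, Y j ω ∂μ = m := by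
    rw [integral_const_mul, integral_finsetSum _ fun j _ => (hL2 j).integrable one_le_two]
    simp only [hm, Finset.sum_const, Finset.card_range, nsmul_eq_mul]
    field_simp
  have hvar : ∫ ω, ((N : ℝ)⁻¹ * ∑ j ∈ Finset.range N, Y j ω - m) ^ 2 ∂μ ≤ D ^ 2 / N := by
    have h1 := variance_eq_integral (μ := μ) hsum.aestronglyMeasurable.aemeasurable
    rw [hmean] at h1
    rw [← h1, variance_const_mul]
    have h2 := IndepFun.variance_sum (s := Finset.range N) (fun j _ => hL2 j)
      (fun i _ j _ hij => hind hij)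
    have h3 : (fun ω => ∑ j ∈ Finset.range N, Y j ω) = ∑ j ∈ Finset.range N, Y j := by
      ext ω; simp
    rw [h3, h2]
    have h4 : ∑ j ∈ Finset.range N, variance (Y j) μ ≤ N * D ^ 2 := by
      rw [← nsmul_eq_mul]
      nth_rewrite 2 [← Finset.card_range N]
      refine Finset.sum_le_card_nsmul _ _ _ fun j _ => ?_
      refine (variance_le_sq_of_bounded (hD j) (hY j).aemeasurable).trans ?_
      nlinarith [sq_nonneg D]
    refine (mul_le_mul_of_nonneg_left h4 (by positivity)).trans_eq ?_
    field_simp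
  refine ⟨hdev.integrable one_le_two, ?_⟩
  calc ∫ ω, |(N : ℝ)⁻¹ * ∑ j ∈ Finset.range N, Y j ω - m| ∂μ
      ≤ ∫ ω, (r + r⁻¹ * ((N : ℝ)⁻¹ * ∑ j ∈ Finset.range N, Y j ω - m) ^ 2) ∂μ := by
        refine integral_mono (hdev.integrable one_le_two).abs
          ((integrable_const r).add (hdev.integrable_sq.const_mul _)) fun ω => ?_
        simp only
        set y := (N : ℝ)⁻¹ * ∑ j ∈ Finset.range N, Y j ω - m
        rw [← sq_abs y, ← sub_nonneg]
        have : r + r⁻¹ * |y| ^ 2 - |y| = r⁻¹ * ((|y| - r / 2) ^ 2 + 3 / 4 * r ^ 2) := by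
          field_simp; ring
        rw [this]; positivity
    _ = r + r⁻¹ * ∫ ω, ((N : ℝ)⁻¹ * ∑ j ∈ Finset.range N, Y j ω - m) ^ 2 ∂μ := by
        rw [integral_add (integrable_const r) (hdev.integrable_sq.const_mul _),
          integral_const_mul]
        simp
    _ ≤ r + r⁻¹ * (D ^ 2 / N) := by gcongr
    _ = r + D ^ 2 / (N * r) := by congr 1; field_simp

/-- The grid comparison with `κ = α⁻¹` replaces two infima over the line by `J + 1` deviations of
sample means, each small in mean. -/
theorem integral_abs_empCVaR_sub_le [IsProbabilityMeasure P] [IsProbabilityMeasure μ] {α : ℝ}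
    (hα₀ : 0 < α) (hα₁ : α ≤ 1) {ξ : ℕ → Ω → X}
    (hξ : ∀ j, Measurable (ξ j)) (hlaw : ∀ j, μ.map (ξ j) = P) (hind : iIndepFun ξ μ) {N : ℕ}
    (hN : 0 < N) {Z : X → ℝ} (hZ : Measurable Z) {a δ r : ℝ} (hδ : 0 < δ) (hr : 0 < r) {J : ℕ}
    (hZb : ∀ᵐ x ∂P, Z x ∈ Icc a (a + J * δ)) :
    ∫ ω, |empCVaR α N (fun j => Z (ξ j ω)) - CVaR α P Z| ∂μ ≤
      δ + α⁻¹ * ((J + 1) * (r + (J * δ) ^ 2 / (N * r))) := by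
  have hN' : (0 : ℝ) < N := by exact_mod_cast hN
  have hsamp : ∀ j, ∀ᵐ ω ∂μ, Z (ξ j ω) ∈ Icc a (a + J * δ) := fun j => by
    rw [← hlaw j] at hZb
    exact ae_of_ae_map (hξ j).aemeasurable hZb
  set g₁ : Ω → ℝ → ℝ := fun ω η => (N : ℝ)⁻¹ * ∑ j ∈ Finset.range N, max (Z (ξ j ω) - η) 0
  set g₂ : ℝ → ℝ := fun η => ∫ x, max (Z x - η) 0 ∂P with hg₂
  have hdev : ∀ i ∈ Finset.range (J + 1), Integrable (fun ω => g₁ ω (a + i * δ) - g₂ (a + i * δ)) μ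
      ∧ ∫ ω, |g₁ ω (a + i * δ) - g₂ (a + i * δ)| ∂μ ≤ r + (J * δ) ^ 2 / (N * r) := by
    intro i _
    have hf : Measurable fun x => max (Z x - (a + i * δ)) 0 := by fun_prop
    refine integral_abs_mean_sub_le (Y := fun j ω => max (Z (ξ j ω) - (a + i * δ)) 0)
      (fun j => hf.comp (hξ j)) (fun j k hjk => (hind.indepFun hjk).comp hf hf) (fun j => ?_)
      (fun j => ?_) hN hr
    · filter_upwards [hsamp j] with ω hω
      have : 0 ≤ (i : ℝ) * δ := by positivity
      exact ⟨le_max_right _ _, max_le (by linarith [hω.2]) (by positivity)⟩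
    · simp only [hg₂]
      rw [← hlaw j, integral_map (hξ j).aemeasurable hf.aestronglyMeasurable]
  have hpt : ∀ᵐ ω ∂μ, |empCVaR α N (fun j => Z (ξ j ω)) - CVaR α P Z| ≤
      δ + α⁻¹ * ∑ i ∈ Finset.range (J + 1), |g₁ ω (a + i * δ) - g₂ (a + i * δ)| := by
    filter_upwards [ae_all_iff.2 hsamp] with ω hω
    obtain ⟨p1, p2, p3, p4⟩ := empExcess_properties hN (z := fun j => Z (ξ j ω))
      (fun j _ => hω j)
    obtain ⟨q1, q2, q3, q4⟩ := excess_properties hZ hZb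
    have := abs_iInf_sub_iInf_le_grid ((one_le_inv₀ hα₀).2 hα₁) p1 q1 p2 q2 hδ p3 q3 p4 q4
    have hemp : empCVaR α N (fun j => Z (ξ j ω)) = ⨅ η, (η + α⁻¹ * g₁ ω η) := by
      unfold empCVaR
      congr 1; ext η
      rw [mul_inv]; ring
    rw [hemp]
    exact this
  have hint : Integrable (fun ω => ∑ i ∈ Finset.range (J + 1),
      |g₁ ω (a + i * δ) - g₂ (a + i * δ)|) μ :=
    integrable_finsetSum _ fun i hi => (hdev i hi).1.abs
  calc ∫ ω, |empCVaR α N (fun j => Z (ξ j ω)) - CVaR α P Z| ∂μ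
      ≤ ∫ ω, (δ + α⁻¹ * ∑ i ∈ Finset.range (J + 1), |g₁ ω (a + i * δ) - g₂ (a + i * δ)|) ∂μ :=
        integral_mono_of_nonneg (Eventually.of_forall fun ω => abs_nonneg _)
          ((integrable_const δ).add (hint.const_mul _)) hpt
    _ = δ + α⁻¹ * ∑ i ∈ Finset.range (J + 1), ∫ ω, |g₁ ω (a + i * δ) - g₂ (a + i * δ)| ∂μ := by
        rw [integral_add (integrable_const δ) (hint.const_mul _), integral_const_mul,
          integral_finsetSum _ fun i hi => (hdev i hi).1.abs]
        simp
    _ ≤ δ + α⁻¹ * ((J + 1) * (r + (J * δ) ^ 2 / (N * r))) := by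
        have h4 := Finset.sum_le_card_nsmul _ _ _ fun i hi => (hdev i hi).2
        rw [Finset.card_range, nsmul_eq_mul] at h4
        push_cast at h4
        gcongr

end Sampling

theorem measurable_cvar_component {n m : ℕ} {C : Vec n → Vec m → Vec n}
    (hC : Measurable (Function.uncurry C)) (i : Fin n) :
    Measurable fun p : Vec n × Vec m => C p.1 p.2 i :=
  (measurable_pi_apply i).comp ((WithLp.measurable_ofLp 2 _).comp hC)

theorem norm_le_sum_abs {n : ℕ} (v : Vec n) : ‖v‖ ≤ ∑ i, |v i| := by
  have h1 : v = ∑ i, v i • EuclideanSpace.single i (1 : ℝ) := by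
    ext j; simp [Finset.sum_apply, Pi.single_apply]
  conv_lhs => rw [h1]
  refine (norm_sum_le _ _).trans_eq (Finset.sum_congr rfl fun i _ => ?_)
  simp [norm_smul]

/-- The expected estimation error is small for large samples, uniformly in the point `h` and in
the sampling space, as long as the error is almost surely bounded by `B`. -/
theorem exists_integral_norm_estError_le {n m : ℕ} {C : Vec n → Vec m → Vec n}
    (hC : Measurable (Function.uncurry C)) {P : Measure (Vec m)} [IsProbabilityMeasure P] {α : ℝ}
    (hα₀ : 0 < α) (hα₁ : α ≤ 1) (B : ℝ) {τ : ℝ} (hτ : 0 < τ) :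
    ∃ N₀ : ℕ, 0 < N₀ ∧ ∀ {Ω : Type u} [MeasurableSpace Ω] (μ : Measure Ω) [IsProbabilityMeasure μ]
      (ξ : ℕ → Ω → Vec m) (_ : ∀ j, Measurable (ξ j)) (_ : ∀ j, μ.map (ξ j) = P)
      (_ : iIndepFun ξ μ) (N : ℕ) (_ : N₀ ≤ N) (h : Vec n)
      (_ : ∀ᵐ ω ∂μ, ‖estError α P C N (fun j => ξ j ω) h‖ ≤ B),
      ∫ ω, ‖estError α P C N (fun j => ξ j ω) h‖ ∂μ ≤ τ := by
  obtain ⟨δ, hδ, hδτ⟩ : ∃ δ : ℝ, 0 < δ ∧ n * δ ≤ τ / 2 := by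
    refine ⟨τ / (2 * (n + 1)), by positivity, ?_⟩
    rw [mul_div_assoc', div_le_div_iff₀ (by positivity) two_pos]
    nlinarith
  -- The interval containing the costs moves with `h`, but its length is at most `2 * B`; hence the
  -- grid size, and with it the sample size, does not depend on `h`.
  obtain ⟨J, hJ⟩ : ∃ J : ℕ, 2 * B ≤ J * δ := by
    obtain ⟨J, hJ⟩ := exists_nat_ge (2 * B / δ)
    exact ⟨J, (div_le_iff₀ hδ).1 hJ⟩
  obtain ⟨r, hr, hrτ⟩ : ∃ r : ℝ, 0 < r ∧ n * (α⁻¹ * ((J + 1) * (2 * r))) ≤ τ / 2 := by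
    refine ⟨τ / (4 * (n + 1) * (α⁻¹ * (J + 1))), by positivity, ?_⟩
    have : n * (α⁻¹ * ((J + 1) * (2 * (τ / (4 * (n + 1) * (α⁻¹ * (J + 1)))))))
        = (n / (n + 1)) * (τ / 2) := by field_simp; norm_num
    rw [this]
    refine mul_le_of_le_one_left (by positivity) ?_
    rw [div_le_one (by positivity)]; linarith
  obtain ⟨N₀, hN₀⟩ := exists_nat_ge ((J * δ) ^ 2 / (r * r))
  refine ⟨N₀ + 1, by omega, ?_⟩
  intro Ω _ μ _ ξ hξ hlaw hind N hN h hb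
  have hNpos : 0 < N := by omega
  have hN' : (0 : ℝ) < N := by exact_mod_cast hNpos
  have hNr : (J * δ) ^ 2 / (N * r) ≤ r := by
    have h1 : (N₀ : ℝ) ≤ N := by exact_mod_cast (by omega : N₀ ≤ N)
    have h2 := hN₀.trans h1
    rw [div_le_iff₀ (by positivity)] at h2 ⊢
    linarith
  have hZ : ∀ i, Measurable fun x => C h x i := fun i =>
    (measurable_cvar_component hC i).comp measurable_prodMk_left
  set e : Fin n → Ω → ℝ := fun i ω =>
    |empCVaR α N (fun j => C h (ξ j ω) i) - CVaR α P fun x => C h x i| with he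
  have hele : ∀ i ω, e i ω ≤ ‖estError α P C N (fun j => ξ j ω) h‖ := fun i ω =>
    PiLp.norm_apply_le (estError α P C N (fun j => ξ j ω) h) i
  have hemeas : ∀ i, Measurable (e i) := fun i =>
    (((measurable_empCVaR hα₀ hα₁ hNpos).comp
      (measurable_pi_iff.2 fun j => (hZ i).comp (hξ j))).sub_const _).abs
  have heint : ∀ i, Integrable (e i) μ := fun i =>
    (memLp_of_bounded (a := 0) (b := B)
      (hb.mono fun ω hω => ⟨abs_nonneg _, (hele i ω).trans hω⟩)
      (hemeas i).aestronglyMeasurable 1).integrable le_rfl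
  have hei : ∀ i, ∫ ω, e i ω ∂μ ≤ δ + α⁻¹ * ((J + 1) * (2 * r)) := fun i => by
    have hmem := ae_mem_Icc_of_empCVaR_bound hα₀ hα₁ hξ hlaw hind hNpos (hZ i)
      (c := CVaR α P fun x => C h x i) (B := B) (hb.mono fun ω hω => (hele i ω).trans hω)
    refine (integral_abs_empCVaR_sub_le hα₀ hα₁ hξ hlaw hind hNpos (hZ i) hδ hr (J := J)
      (hmem.mono fun x hx => ⟨hx.1, hx.2.trans (by linarith)⟩)).trans ?_
    gcongr
    linarith
  calc ∫ ω, ‖estError α P C N (fun j => ξ j ω) h‖ ∂μ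
      ≤ ∫ ω, ∑ i, e i ω ∂μ :=
        integral_mono_of_nonneg (Eventually.of_forall fun ω => norm_nonneg _)
          (integrable_finsetSum _ fun i _ => heint i)
          (Eventually.of_forall fun ω => norm_le_sum_abs _)
    _ = ∑ i, ∫ ω, e i ω ∂μ := integral_finsetSum _ fun i _ => heint i
    _ ≤ n * (δ + α⁻¹ * ((J + 1) * (2 * r))) := by
        refine (Finset.sum_le_card_nsmul _ _ _ fun i _ => hei i).trans_eq ?_
        simp [mul_add]
    _ ≤ τ := by rw [mul_add]; linarith

/-! ### Martingale convergence and averaging over fresh samples. -/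

/-- Square-summable step sizes make the centered sums of a bounded adapted sequence converge. -/
theorem ae_exists_tendsto_sum_centered {Ω : Type*} {m₀ : MeasurableSpace Ω} {μ : Measure Ω}
    [IsProbabilityMeasure μ] (ℱ : Filtration ℕ m₀) {X : ℕ → Ω → ℝ} {B : ℝ}
    (hX : ∀ k, StronglyMeasurable[ℱ (k + 1)] (X k)) (hXB : ∀ k, ∀ᵐ ω ∂μ, |X k ω| ≤ B)
    {γ : ℕ → ℝ} (hγ : Summable fun k => γ k ^ 2) :
    ∀ᵐ ω ∂μ, ∃ c, Tendsto (fun n => ∑ k ∈ Finset.range n, γ k * (X k ω - (μ[X k|ℱ k]) ω))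
      atTop (𝓝 c) := by
  set s : ℕ → Ω → ℝ := fun k ω => γ k * (X k ω - (μ[X k|ℱ k]) ω) with hs
  set M : ℕ → Ω → ℝ := fun n ω => ∑ k ∈ Finset.range n, s k ω with hM
  have hXi : ∀ k, Integrable (X k) μ := fun k =>
    Integrable.of_bound ((hX k).mono (ℱ.le _)).aestronglyMeasurable B (hXB k)
  have hsm : ∀ k, StronglyMeasurable[ℱ (k + 1)] (s k) := fun k =>
    ((hX k).sub (stronglyMeasurable_condExp.mono (ℱ.mono k.le_succ))).const_mul _
  have hsB : ∀ k, ∀ᵐ ω ∂μ, |s k ω| ≤ |γ k| * (2 * B) := fun k => by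
    have h1 := ae_bdd_abs_condExp_of_ae_bdd_abs (m := ℱ k) (hXB k)
    filter_upwards [hXB k, h1] with ω e1 e2
    rw [hs]
    simp only [abs_mul]
    gcongr
    exact (abs_sub _ _).trans (by linarith)
  have hsL2 : ∀ k, MemLp (s k) 2 μ := fun k =>
    MemLp.of_bound ((hsm k).mono (ℱ.le _)).aestronglyMeasurable _ (hsB k)
  have hs0 : ∀ k, μ[s k|ℱ k] =ᵐ[μ] 0 := fun k => by
    have h1 : s k = γ k • (X k - μ[X k|ℱ k]) := rfl
    rw [h1]
    refine (condExp_smul _ _ _).trans ?_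
    have h2 := condExp_sub (hXi k) (integrable_condExp (m := ℱ k) (f := X k) (μ := μ)) (ℱ k)
    have h3 : μ[μ[X k|ℱ k]|ℱ k] = μ[X k|ℱ k] :=
      condExp_of_stronglyMeasurable (ℱ.le k) stronglyMeasurable_condExp integrable_condExp
    filter_upwards [h2] with ω hω
    rw [Pi.smul_apply, hω, h3]
    simp
  have hMm : ∀ n, StronglyMeasurable[ℱ n] (M n) := fun n =>
    Finset.stronglyMeasurable_fun_sum _ fun k hk =>
      (hsm k).mono (ℱ.mono (Finset.mem_range.1 hk))
  have hML2 : ∀ n, MemLp (M n) 2 μ := fun n => memLp_finsetSum _ fun k _ => hsL2 k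
  have hMs : ∀ n, M (n + 1) = M n + s n := fun n => by
    ext ω; exact Finset.sum_range_succ _ _
  have hmart : Martingale M ℱ μ := by
    refine martingale_of_condExp_sub_eq_zero_nat hMm (fun n => (hML2 n).integrable one_le_two)
      fun n => ?_
    rw [hMs, add_sub_cancel_left]
    exact hs0 n
  have hcross : ∀ n, ∫ ω, M n ω * s n ω ∂μ = 0 := fun n => by
    have hint : Integrable (M n * s n) μ := (hML2 n).integrable_mul (hsL2 n)
    have h1 := condExp_mul_of_stronglyMeasurable_left (hMm n) hint
      ((hsL2 n).integrable one_le_two)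
    have h2 : ∫ ω, M n ω * s n ω ∂μ = ∫ ω, (μ[M n * s n|ℱ n]) ω ∂μ :=
      (integral_condExp (ℱ.le n)).symm
    rw [h2]
    refine integral_eq_zero_of_ae ?_
    filter_upwards [h1, hs0 n] with ω e1 e2
    rw [e1, Pi.mul_apply, e2]; simp
  set Γ := ∑' k, γ k ^ 2
  -- Martingale increments are orthogonal, so second moments add up and `|x| ≤ 1 + x²` turns them
  -- into the uniform `L¹` bound required for convergence.
  have hsq : ∀ n, ∫ ω, M n ω ^ 2 ∂μ ≤ (∑ k ∈ Finset.range n, γ k ^ 2) * (2 * B) ^ 2 := by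
    intro n
    induction n with
    | zero => simp [hM]
    | succ n ih =>
      have e1 : ∫ ω, M (n + 1) ω ^ 2 ∂μ =
          ∫ ω, M n ω ^ 2 ∂μ + 2 * ∫ ω, M n ω * s n ω ∂μ + ∫ ω, s n ω ^ 2 ∂μ := by
        have i1 := (hML2 n).integrable_sq
        have i2 : Integrable (fun ω => 2 * (M n ω * s n ω)) μ :=
          ((hML2 n).integrable_mul (hsL2 n)).const_mul 2
        have i3 := (hsL2 n).integrable_sq
        have i12 : Integrable (fun ω => M n ω ^ 2 + 2 * (M n ω * s n ω)) μ := i1.add i2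
        rw [← integral_const_mul, ← integral_add i1 i2, ← integral_add i12 i3]
        refine integral_congr_ae (Eventually.of_forall fun ω => ?_)
        simp only [hMs, Pi.add_apply]; ring
      have e2 : ∫ ω, s n ω ^ 2 ∂μ ≤ γ n ^ 2 * (2 * B) ^ 2 := by
        have : ∫ ω, s n ω ^ 2 ∂μ ≤ ∫ _, (|γ n| * (2 * B)) ^ 2 ∂μ := by
          refine integral_mono_ae (hsL2 n).integrable_sq (integrable_const _) ?_
          filter_upwards [hsB n] with ω hω
          rw [← sq_abs (s n ω)]
          gcongr
        simpa [mul_pow] using this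
      rw [e1, hcross, Finset.sum_range_succ]
      linarith
  refine Submartingale.exists_ae_tendsto_of_bdd hmart.submartingale
    (R := Real.toNNReal (1 + Γ * (2 * B) ^ 2)) fun n => ?_
  rw [eLpNorm_one_eq_lintegral_enorm,
    ← ofReal_integral_norm_eq_lintegral_enorm ((hML2 n).integrable one_le_two)]
  change ENNReal.ofReal _ ≤ ENNReal.ofReal _
  refine ENNReal.ofReal_le_ofReal ?_
  calc ∫ ω, ‖M n ω‖ ∂μ ≤ ∫ ω, (1 + M n ω ^ 2) ∂μ := by
        refine integral_mono ((hML2 n).integrable one_le_two).norm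
          ((integrable_const _).add (hML2 n).integrable_sq) fun ω => ?_
        simp only [Real.norm_eq_abs]
        rw [← sq_abs (M n ω)]
        nlinarith [sq_nonneg (|M n ω| - 1), abs_nonneg (M n ω)]
    _ = 1 + ∫ ω, M n ω ^ 2 ∂μ := by
        rw [integral_add (integrable_const _) (hML2 n).integrable_sq]; simp
    _ ≤ 1 + Γ * (2 * B) ^ 2 := by
        gcongr
        refine (hsq n).trans ?_
        gcongr
        exact hγ.sum_le_tsum _ fun k _ => sq_nonneg _

section Freezing

variable {Ω E T : Type*} {m m₀ : MeasurableSpace Ω} {μ : Measure Ω} [IsProbabilityMeasure μ]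
  [MeasurableSpace E] [MeasurableSpace T]

/-- This passes from a bound along the random iterate to a bound over fresh samples at almost every
frozen value of the iterate, as the estimate at a fixed point requires. -/
theorem ae_ae_of_ae_of_indepFun {H : Ω → E} {Y : Ω → T} (hH : Measurable H) (hY : Measurable Y)
    (hind : IndepFun H Y μ) {D : Set (E × T)} (hD : MeasurableSet D)
    (h : ∀ᵐ ω ∂μ, (H ω, Y ω) ∈ D) : ∀ᵐ ω ∂μ, ∀ᵐ ω' ∂μ, (H ω, Y ω') ∈ D := by
  have h1 := (indepFun_iff_map_prod_eq_prod_map_map hH.aemeasurable hY.aemeasurable).1 hind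
  have h2 : ∀ᵐ p ∂(μ.map H).prod (μ.map Y), p ∈ D := by
    rw [← h1]
    exact (ae_map_iff (hH.prodMk hY).aemeasurable hD).2 h
  have h3 := ae_of_ae_map hH.aemeasurable (Measure.ae_ae_of_ae_prod h2)
  filter_upwards [h3] with ω hω
  exact ae_of_ae_map hY.aemeasurable hω

/-- If `H` is measurable for a σ-algebra that is independent of `Y`, then `f (H, Y)` is averaged
over `Y` alone. -/
theorem condExp_le_of_indep (hm : m ≤ m₀) {H : Ω → E} {Y : Ω → T}
    (hH : Measurable[m] H) (hY : Measurable Y) (hind : Indep m (MeasurableSpace.comap Y ‹_›) μ)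
    {f : E × T → ℝ} (hf : Measurable f) (hint : Integrable (fun ω => f (H ω, Y ω)) μ) {τ : ℝ}
    (hτ : ∀ᵐ ω ∂μ, ∫ ω', f (H ω, Y ω') ∂μ ≤ τ) :
    ∀ᵐ ω ∂μ, (μ[fun ω => f (H ω, Y ω)|m]) ω ≤ τ := by
  refine ae_le_of_ae_le_trim (hm := hm) ?_
  refine ae_le_of_forall_setIntegral_le (integrable_condExp.trim hm stronglyMeasurable_condExp)
    (integrable_const τ) fun s hs _ => ?_
  rw [← setIntegral_trim hm stronglyMeasurable_condExp hs, setIntegral_condExp hm hint hs]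
  have hs0 := hm s hs
  -- Adjoining the indicator of the test set `s` to `H` keeps independence of `Y`, so Fubini applies
  -- directly to the integral over `s`.
  set G : Ω → E × ℝ := fun ω => (H ω, s.indicator 1 ω) with hG
  have hGm : Measurable[m] G := by
    refine hH.prodMk (Measurable.indicator ?_ hs)
    exact @measurable_const _ _ _ m 1
  have hG0 : Measurable G := hGm.mono hm le_rfl
  have hGY : IndepFun G Y μ := by
    rw [IndepFun_iff_Indep]
    exact indep_of_indep_of_le_left hind hGm.comap_le
  have hmap := (indepFun_iff_map_prod_eq_prod_map_map hG0.aemeasurable hY.aemeasurable).1 hGY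
  set φ : (E × ℝ) × T → ℝ := fun p => p.1.2 * f (p.1.1, p.2) with hφ
  have hφm : Measurable φ := by fun_prop
  have e1 : ∀ ω, φ (G ω, Y ω) = s.indicator (fun ω => f (H ω, Y ω)) ω := fun ω => by
    by_cases hω : ω ∈ s <;> simp [hφ, hG, hω]
  have hφi : Integrable φ ((μ.map G).prod (μ.map Y)) := by
    rw [← hmap, integrable_map_measure hφm.aestronglyMeasurable (hG0.prodMk hY).aemeasurable]
    refine (hint.indicator hs0).congr (Eventually.of_forall fun ω => (e1 ω).symm)
  have e2 : ∀ ω, ∫ y, φ (G ω, y) ∂μ.map Y = s.indicator 1 ω * ∫ ω', f (H ω, Y ω') ∂μ := fun ω => by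
    simp only [hφ, hG]
    have hfω : Measurable fun y => f (H ω, y) := hf.comp measurable_prodMk_left
    rw [integral_const_mul, integral_map hY.aemeasurable hfω.aestronglyMeasurable]
  have hI : Integrable (fun ω => s.indicator 1 ω * ∫ ω', f (H ω, Y ω') ∂μ) μ :=
    (hφi.integral_prod_left.comp_measurable hG0).congr (Eventually.of_forall e2)
  have e3 : ∫ ω in s, f (H ω, Y ω) ∂μ = ∫ ω, s.indicator 1 ω * ∫ ω', f (H ω, Y ω') ∂μ ∂μ := by
    rw [← integral_indicator hs0, ← integral_congr_ae (Eventually.of_forall e1),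
      ← integral_map (f := φ) (hG0.prodMk hY).aemeasurable hφm.aestronglyMeasurable, hmap,
      integral_prod _ hφi, integral_map hG0.aemeasurable
        hφi.integral_prod_left.aestronglyMeasurable]
    exact integral_congr_ae (Eventually.of_forall e2)
  rw [e3, ← setIntegral_trim hm stronglyMeasurable_const hs, ← integral_indicator hs0]
  refine integral_mono_ae hI ((integrable_const τ).indicator hs0) ?_
  filter_upwards [hτ] with ω hω
  by_cases hωs : ω ∈ s <;> simp [hωs, hω]

end Freezing

/-! ### Adaptedness of the iterates. -/

/-- The σ-algebras generated by the samples of the iterations before `k`. -/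
def sampleFiltration {Ω X : Type*} {m₀ : MeasurableSpace Ω} [mX : MeasurableSpace X]
    {ξ : ℕ → ℕ → Ω → X} (hξ : ∀ k j, Measurable (ξ k j)) : Filtration ℕ m₀ where
  seq k := ⨆ p ∈ {p : ℕ × ℕ | p.1 < k}, MeasurableSpace.comap (ξ p.1 p.2) mX
  mono' _ _ hij := biSup_mono fun _ hp => lt_of_lt_of_le hp hij
  le' _ := iSup₂_le fun p _ => (hξ p.1 p.2).comap_le

theorem measurable_samples_sampleFiltration {Ω X : Type*} {m₀ : MeasurableSpace Ω}
    [mX : MeasurableSpace X] {ξ : ℕ → ℕ → Ω → X} (hξ : ∀ k j, Measurable (ξ k j)) (k : ℕ) :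
    Measurable[sampleFiltration hξ (k + 1)] fun ω j => ξ k j ω := by
  refine (@measurable_pi_iff _ _ _ (_) _ _).2 fun j => ?_
  rw [measurable_iff_comap_le]
  exact le_iSup₂_of_le (f := fun (p : ℕ × ℕ) (_ : p ∈ {p : ℕ × ℕ | p.1 < k + 1}) =>
    MeasurableSpace.comap (ξ p.1 p.2) mX) (k, j) (Nat.lt_succ_self k) le_rfl

theorem indep_sampleFiltration {Ω X : Type*} {m₀ : MeasurableSpace Ω} {μ : Measure Ω}
    [mX : MeasurableSpace X] {ξ : ℕ → ℕ → Ω → X} (hξ : ∀ k j, Measurable (ξ k j))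
    (hind : iIndepFun (fun p : ℕ × ℕ => ξ p.1 p.2) μ) (k : ℕ) :
    Indep (sampleFiltration hξ k) (MeasurableSpace.comap (fun ω j => ξ k j ω) inferInstance) μ := by
  have h1 := indep_iSup_of_disjoint (m := fun p : ℕ × ℕ => MeasurableSpace.comap (ξ p.1 p.2) mX)
    (fun p => (hξ p.1 p.2).comap_le) hind.iIndep
    (S := {p : ℕ × ℕ | p.1 < k}) (T := {p : ℕ × ℕ | p.1 = k})
    (disjoint_left.2 fun p hp hp' => (ne_of_lt hp) hp')
  refine indep_of_indep_of_le_right h1 ?_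
  rw [← measurable_iff_comap_le]
  refine (@measurable_pi_iff _ _ _ (_) _ _).2 fun j => ?_
  rw [measurable_iff_comap_le]
  exact le_iSup₂_of_le (f := fun (p : ℕ × ℕ) (_ : p ∈ {p : ℕ × ℕ | p.1 = k}) =>
    MeasurableSpace.comap (ξ p.1 p.2) mX) (k, j) rfl le_rfl

theorem measurable_estError {n m : ℕ} {C : Vec n → Vec m → Vec n}
    (hC : Measurable (Function.uncurry C)) {P : Measure (Vec m)} {α : ℝ} (hα₀ : 0 < α)
    (hα₁ : α ≤ 1) (hcont : Continuous (cvarMap α P C)) {N : ℕ} (hN : 0 < N) :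
    Measurable fun p : Vec n × (ℕ → Vec m) => estError α P C N p.2 p.1 := by
  refine Measurable.sub ?_ (hcont.measurable.comp measurable_fst)
  refine (WithLp.measurable_toLp 2 _).comp (measurable_pi_iff.2 fun i => ?_)
  refine (measurable_empCVaR hα₀ hα₁ hN).comp (measurable_pi_iff.2 fun j => ?_)
  exact (measurable_cvar_component hC i).comp
    (measurable_fst.prodMk ((measurable_pi_apply j).comp measurable_snd))

/-- The iterate at time `k` uses only samples of rounds before `k`, matching the strict inequality
in `sampleFiltration`; it is therefore independent of the samples of round `k`. -/
theorem measurable_iter {Ω : Type*} {m₀ : MeasurableSpace Ω} {n m s : ℕ}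
    {C : Vec n → Vec m → Vec n} (hC : Measurable (Function.uncurry C)) {P : Measure (Vec m)}
    {α : ℝ} (hα₀ : 0 < α) (hα₁ : α ≤ 1) (hcont : Continuous (cvarMap α P C))
    {q : Fin s → Vec n → ℝ} (hq : ∀ i, Measurable (q i)) {g : Fin s → Vec n}
    (hJ : ∀ h lam, jacobianTransposeMul q h lam = combination g lam) {L : Vec n → Vec n}
    (hL : Measurable L) (γ : ℕ → ℝ) {N : ℕ → ℕ} (hN : ∀ k, 0 < N k) (h₀ : Vec n) (lam₀ : Vec s)
    {ξ : ℕ → ℕ → Ω → Vec m} (hξ : ∀ k j, Measurable (ξ k j)) (k : ℕ) :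
    Measurable[sampleFiltration hξ k] fun ω =>
      iter α P C q L γ N h₀ lam₀ (fun k j => ξ k j ω) k := by
  induction k with
  | zero => exact @measurable_const _ _ _ (sampleFiltration hξ 0) _
  | succ k ih =>
    have ih' := ih.mono ((sampleFiltration hξ).mono k.le_succ) le_rfl
    have hpair := ih'.prodMk (measurable_samples_sampleFiltration hξ k)
    set Φ : (Vec n × Vec s) × (ℕ → Vec m) → Vec n × Vec s := fun p =>
      (p.1.1 - γ k • L (cvarMap α P C p.1.1 + combination g p.1.2
          + estError α P C (N k) p.2 p.1.1),
        WithLp.toLp 2 fun i => max (p.1.2 i + γ k * q i p.1.1) 0) with hΦ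
    have hh : Measurable fun p : (Vec n × Vec s) × (ℕ → Vec m) => p.1.1 :=
      measurable_fst.comp measurable_fst
    have hl : Measurable fun p : (Vec n × Vec s) × (ℕ → Vec m) => p.1.2 :=
      measurable_snd.comp measurable_fst
    have e1 : Measurable fun p : (Vec n × Vec s) × (ℕ → Vec m) => cvarMap α P C p.1.1 := by
      have d := hcont.measurable
      generalize cvarMap α P C = E at d
      exact d.comp hh
    have e2 : Measurable fun p : (Vec n × Vec s) × (ℕ → Vec m) => combination g p.1.2 :=
      (combination g).continuous.measurable.comp hl
    have e3 : Measurable fun p : (Vec n × Vec s) × (ℕ → Vec m) =>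
        estError α P C (N k) p.2 p.1.1 := by
      have d := measurable_estError hC hα₀ hα₁ hcont (hN k)
      generalize estError α P C (N k) = E at d
      exact d.comp (hh.prodMk measurable_snd)
    have e4 : ∀ i, Measurable fun p : (Vec n × Vec s) × (ℕ → Vec m) =>
        max (p.1.2 i + γ k * q i p.1.1) 0 := fun i => by
      have d1 : Measurable fun p : (Vec n × Vec s) × (ℕ → Vec m) => p.1.2 i :=
        (measurable_pi_apply i).comp ((WithLp.measurable_ofLp 2 _).comp hl)
      have d2 : Measurable fun p : (Vec n × Vec s) × (ℕ → Vec m) => q i p.1.1 := (hq i).comp hh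
      exact (d1.add (d2.const_mul _)).max measurable_const
    have hΦm : Measurable Φ :=
      Measurable.prodMk (hh.sub (Measurable.fun_const_smul (hL.comp ((e1.add e2).add e3)) _))
        ((WithLp.measurable_toLp 2 _).comp (measurable_pi_iff.2 e4))
    convert hΦm.comp hpair using 1
    ext1 ω
    simp only [iter, hJ, hΦ, Function.comp_apply]

theorem tendsto_zero_of_summable_sq {γ : ℕ → ℝ} (hγ : Summable fun k => γ k ^ 2) :
    Tendsto γ atTop (𝓝 0) := by
  have h1 := hγ.tendsto_atTop_zero.sqrt
  rw [Real.sqrt_zero] at h1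
  simp_rw [Real.sqrt_sq_eq_abs] at h1
  exact (tendsto_zero_iff_abs_tendsto_zero _).2 h1

/-! ### Combination of the descent and the noise estimates. -/

/-- The multiplier iteration converges to a neighbourhood of the solution once the errors are
bounded by a sequence whose centered, step-weighted sums converge and whose compensator is small. -/
theorem eventually_norm_sub_le {n s : ℕ} {F : Vec n → Vec n} {S : Submodule ℝ (Vec n)}
    {g : Fin s → Vec n} {q : Fin s → Vec n → ℝ} {hstar : Vec n} {B ε c θ η K a : ℝ}
    {W : Vec n → Vec s → ℝ} (hθ : 0 < θ) (hη : 0 < η) (hK : 0 < K)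
    (hW : ∀ (h : Vec n) (lam : Vec s), ‖h‖ ≤ B → ‖lam‖ ≤ B → (∀ i, 0 ≤ lam i) →
      h - hstar ∈ Sᗮ →
        (W h lam ≤ c + η → ‖h - hstar‖ ≤ ε) ∧
        ∀ (β : Vec n) (γ : ℝ), ‖β‖ ≤ B → 0 ≤ γ → γ ≤ 1 →
          W (h - γ • Sᗮ.starProjection (F h + combination g lam + β))
              (dualStep lam γ (constraintVec q h)) ≤ W h lam + K * γ ∧
          (c ≤ W h lam →
            W (h - γ • Sᗮ.starProjection (F h + combination g lam + β))
                (dualStep lam γ (constraintVec q h)) ≤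
              W h lam - γ * θ + γ * K * ‖β‖ + K * γ ^ 2))
    {γ : ℕ → ℝ} (hγ0 : ∀ k, 0 < γ k)
    (hγs : Tendsto (fun K => ∑ k ∈ Finset.range K, γ k) atTop atTop)
    (hγ2 : Summable fun k => γ k ^ 2) {h : ℕ → Vec n} {lam : ℕ → Vec s} {β : ℕ → Vec n}
    {e : ℕ → ℝ} (hh : ∀ k, h (k + 1) =
      h k - γ k • Sᗮ.starProjection (F (h k) + combination g (lam k) + β k))
    (hlam : ∀ k, lam (k + 1) = dualStep (lam k) (γ k) (constraintVec q (h k)))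
    (hh0 : h 0 - hstar ∈ Sᗮ) (hlam0 : ∀ i, 0 ≤ lam 0 i)
    (hB : ∀ k, ‖h k‖ ≤ B ∧ ‖lam k‖ ≤ B ∧ ‖β k‖ ≤ B) (he : ∀ k, e k ≤ θ / (2 * K))
    (hconv : Tendsto (fun n => ∑ k ∈ Finset.range n, γ k * (‖β k‖ - e k)) atTop (𝓝 a)) :
    ∀ᶠ k in atTop, ‖h k - hstar‖ ≤ ε := by
  have hhS : ∀ k, h k - hstar ∈ Sᗮ := fun k => by
    induction k with
    | zero => exact hh0
    | succ k ih =>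
      rw [hh, sub_right_comm]
      exact Submodule.sub_mem _ ih
        (Submodule.smul_mem _ _ (Submodule.starProjection_apply_mem _ _))
  have hlam_nonneg : ∀ k i, 0 ≤ lam k i := fun k => by
    cases k with
    | zero => exact hlam0
    | succ k => intro i; rw [hlam]; exact le_max_right _ _
  have hγt := tendsto_zero_of_summable_sq hγ2
  have hγ1 : ∀ᶠ k in atTop, γ k ≤ 1 :=
    (hγt.eventually_lt_const one_pos).mono fun k hk => hk.le
  have hr : Tendsto (fun n => ∑ k ∈ Finset.range n, (K * (γ k * (‖β k‖ - e k)) + K * γ k ^ 2))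
      atTop (𝓝 (K * a + K * ∑' k, γ k ^ 2)) := by
    simp_rw [Finset.sum_add_distrib, ← Finset.mul_sum]
    exact (hconv.const_mul K).add (hγ2.hasSum.tendsto_sum_nat.const_mul K)
  have ht : Tendsto (fun k => K * γ k) atTop (𝓝 0) := by simpa using hγt.const_mul K
  -- The compensator costs at most `K * e k ≤ θ / 2` per unit step, so the rate drops to `θ / 2`;
  -- the centered noise and the `γ²` terms form the convergent error series.
  have key := eventually_le_of_descent (W := fun k => W (h k) (lam k)) (c := c)
    (half_pos hθ) hη (fun k => (hγ0 k).le) hγs hr ht ?_ ?_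
  · exact key.mono fun k hk =>
      (hW (h k) (lam k) (hB k).1 (hB k).2.1 (hlam_nonneg k) (hhS k)).1 hk
  · filter_upwards [hγ1] with k hk hc
    have h1 := ((hW (h k) (lam k) (hB k).1 (hB k).2.1 (hlam_nonneg k) (hhS k)).2 (β k) (γ k)
      (hB k).2.2 (hγ0 k).le hk).2 hc
    rw [← hh, ← hlam] at h1
    have h2 : K * e k ≤ θ / 2 := by
      refine (mul_le_mul_of_nonneg_left (he k) hK.le).trans_eq ?_
      field_simp
    have h3 := mul_le_mul_of_nonneg_left h2 (hγ0 k).le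
    linarith
  · filter_upwards [hγ1] with k hk
    have h1 := ((hW (h k) (lam k) (hB k).1 (hB k).2.1 (hlam_nonneg k) (hhS k)).2 (β k) (γ k)
      (hB k).2.2 (hγ0 k).le hk).1
    rw [← hh, ← hlam] at h1
    exact h1

/-- Let `f k (h k, ξ k)` be bounded errors, where `h k` depends on the samples before iteration `k`
only. If their averages over fresh samples are at most `τ`, they have a compensator bounded by `τ`
for which the centered, step-weighted sums converge. -/
theorem ae_exists_compensator {Ω E X : Type*} [MeasurableSpace Ω] {μ : Measure Ω}
    [IsProbabilityMeasure μ] [MeasurableSpace E] [MeasurableSpace X]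
    {f : ℕ → E → (ℕ → X) → ℝ} (hf : ∀ k, Measurable fun p : E × (ℕ → X) => f k p.1 p.2)
    (hf0 : ∀ k x y, 0 ≤ f k x y) {γ : ℕ → ℝ} (hγ2 : Summable fun k => γ k ^ 2)
    {ξ : ℕ → ℕ → Ω → X} (hξ : ∀ k j, Measurable (ξ k j))
    (hind : iIndepFun (fun p : ℕ × ℕ => ξ p.1 p.2) μ) {h : ℕ → Ω → E}
    (hh : ∀ k, Measurable[sampleFiltration hξ k] (h k)) {B τ : ℝ}
    (hB : ∀ᵐ ω ∂μ, ∀ k, f k (h k ω) (fun j => ξ k j ω) ≤ B)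
    (hτ : ∀ k x, (∀ᵐ ω ∂μ, f k x (fun j => ξ k j ω) ≤ B) →
      ∫ ω, f k x (fun j => ξ k j ω) ∂μ ≤ τ) :
    ∀ᵐ ω ∂μ, ∃ (e : ℕ → ℝ) (a : ℝ), (∀ k, e k ≤ τ) ∧
      Tendsto (fun n => ∑ k ∈ Finset.range n, γ k * (f k (h k ω) (fun j => ξ k j ω) - e k))
        atTop (𝓝 a) := by
  set ℱ := sampleFiltration hξ
  set Z : ℕ → Ω → ℝ := fun k ω => f k (h k ω) (fun j => ξ k j ω) with hZ
  have hYm : ∀ k, Measurable fun ω j => ξ k j ω := fun k => measurable_pi_iff.2 (hξ k)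
  have hZm : ∀ k, StronglyMeasurable[ℱ (k + 1)] (Z k) := fun k => by
    have h1 := ((hh k).mono (ℱ.mono k.le_succ) le_rfl).prodMk
      (measurable_samples_sampleFiltration hξ k)
    exact Measurable.stronglyMeasurable ((hf k).comp h1)
  have hZB : ∀ k, ∀ᵐ ω ∂μ, |Z k ω| ≤ B := fun k => by
    filter_upwards [hB] with ω hω
    rw [abs_of_nonneg (hf0 _ _ _)]
    exact hω k
  have hcond : ∀ k, ∀ᵐ ω ∂μ, (μ[Z k|ℱ k]) ω ≤ τ := fun k => by
    refine condExp_le_of_indep (ℱ.le k) (hh k) (hYm k) (indep_sampleFiltration hξ hind k) (hf k)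
      (Integrable.of_bound ((hZm k).mono (ℱ.le _)).aestronglyMeasurable B (hZB k)) ?_
    have hHY : IndepFun (h k) (fun ω j => ξ k j ω) μ := by
      rw [IndepFun_iff_Indep]
      exact indep_of_indep_of_le_left (indep_sampleFiltration hξ hind k) (hh k).comap_le
    have h2 := ae_ae_of_ae_of_indepFun ((hh k).mono (ℱ.le k) le_rfl) (hYm k) hHY
      (measurableSet_le (hf k) measurable_const) (hB.mono fun ω hω => hω k)
    filter_upwards [h2] with ω hω
    exact hτ k (h k ω) hω
  filter_upwards [ae_all_iff.2 hcond, ae_exists_tendsto_sum_centered ℱ hZm hZB hγ2] with ω e1 e2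
  obtain ⟨a, ha⟩ := e2
  exact ⟨_, a, e1, ha⟩

end CVaRVI

open CVaRVI in
theorem proposition3 {n m l s : ℕ}
    -- the uncertain costs, the distribution of the uncertainty and the risk level
    (C : Vec n → Vec m → Vec n) (hC : Measurable (Function.uncurry C))
    (P : Measure (Vec m)) [IsProbabilityMeasure P]
    (α : ℝ) (hα₀ : 0 < α) (hα₁ : α ≤ 1)
    (hfin : ∀ h i, HasFiniteCVaR α P fun x => C h x i)
    (hmono : IsStrictlyMonotone (cvarMap α P C)) (hcont : Continuous (cvarMap α P C))
    -- the constraints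
    (A : Matrix (Fin l) (Fin n) ℝ) (b : Fin l → ℝ) (q : Fin s → Vec n → ℝ)
    (hq : ∀ i, ∃ f : Vec n →ᵃ[ℝ] ℝ, q i = f)
    (hcomp : IsCompact (feasibleSet A b q))
    -- the solution and its multipliers
    (hstar : Vec n) (hsol : hstar ∈ SOL (feasibleSet A b q) (cvarMap α P C))
    (hlicq : LICQ A q hstar)
    (lamstar : Vec s) (mustar : Vec l)
    (hkkt : IsKKTPoint (cvarMap α P C) A b q hstar lamstar mustar)
    -- the matrix `L`
    (u : OrthonormalBasis (Fin n) ℝ (Vec n)) (M : ℕ) (hu : SpansRows A u M) :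
    ∀ ε : ℝ, 0 < ε → ∀ B : ℝ, ∃ Nε : ℕ,
      ∀ {Ω : Type*} [MeasurableSpace Ω] (μ : Measure Ω) [IsProbabilityMeasure μ]
        -- `ξ k j` is the `j`-th sample in iteration `k`
        (ξ : ℕ → ℕ → Ω → Vec m)
        (_ : ∀ k j, Measurable (ξ k j)) (_ : ∀ k j, μ.map (ξ k j) = P)
        (_ : iIndepFun (fun p : ℕ × ℕ => ξ p.1 p.2) μ)
        (γ : ℕ → ℝ) (_ : ∀ k, 0 < γ k)
        (_ : Tendsto (fun K => ∑ k ∈ Finset.range K, γ k) atTop atTop)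
        (_ : Summable fun k => γ k ^ 2)
        (N : ℕ → ℕ) (h₀ : Vec n) (_ : A *ᵥ h₀.ofLp = b)
        (lam₀ : Vec s) (_ : ∀ i, 0 ≤ lam₀ i)
        (h : ℕ → Ω → Vec n) (lam : ℕ → Ω → Vec s)
        (_ : ∀ k ω, (h k ω, lam k ω) =
          iter α P C q (subspaceProj u M) γ N h₀ lam₀ (fun k j => ξ k j ω) k)
        (_ : ∀ᵐ ω ∂μ, ∀ k, ‖h k ω‖ ≤ B ∧ ‖lam k ω‖ ≤ B ∧
          ‖estError α P C (N k) (fun j => ξ k j ω) (h k ω)‖ ≤ B),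
        (∀ k, Nε ≤ N k) →
          ∀ᵐ ω ∂μ, limsup (fun k => ‖h k ω - hstar‖) atTop ≤ ε := by

  intro ε hε B
  set S := Submodule.span ℝ (range (rowVec A)) with hS
  set g : Fin s → Vec n := fun i => gradient (q i) hstar with hg
  have hqg : ∀ i x y, q i x - q i y = inner ℝ (g i) (x - y) := fun i x y => by
    obtain ⟨f, hf⟩ := hq i
    simp only [hg, hf]
    exact affine_sub_eq_inner_gradient f hstar x y
  have hqm : ∀ i, Measurable (q i) := fun i => by
    have : q i = fun x => q i hstar + inner ℝ (g i) (x - hstar) := by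
      ext x; linarith [hqg i x hstar]
    rw [this]
    exact Continuous.measurable (by fun_prop)
  have hJ : ∀ h lam, jacobianTransposeMul q h lam = combination g lam := fun h lam => by
    rw [combination_apply, jacobianTransposeMul]
    refine Finset.sum_congr rfl fun i _ => ?_
    obtain ⟨f, hf⟩ := hq i
    simp only [hg, hf]
    rw [gradient_affine_eq f h hstar]
  have hcompl : ∀ i, lamstar i * q i hstar = 0 := fun i => by
    have hle : ∀ j ∈ Finset.univ, lamstar j * q j hstar ≤ 0 := fun j _ =>
      mul_nonpos_of_nonneg_of_nonpos (hkkt.multiplier_nonneg j) (hkkt.ineq_constraint j)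
    exact (Finset.sum_eq_zero_iff_of_nonpos hle).1 hkkt.complementarity i (Finset.mem_univ i)
  have hstat : cvarMap α P C hstar + combination g lamstar ∈ S := by
    have h1 := hkkt.stationary
    rw [hJ] at h1
    rw [eq_neg_of_add_eq_zero_left h1]
    exact Submodule.neg_mem _ (transpose_mulVec_mem_span_rows A mustar.ofLp)
  -- All constants are fixed before the probability space, the steps and the initial values. `max B
  -- 0` covers a negative `B`.
  obtain ⟨W, c, θ, η, K, hθ, hη, hK, hW⟩ := exists_lyapunov hcont hmono S g q hqg hstar lamstar
    hkkt.multiplier_nonneg hkkt.ineq_constraint hcompl hstat hlicq.exists_bound (max B 0)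
    (le_max_right _ _) hε
  obtain ⟨N₀, hN₀, hest⟩ := exists_integral_norm_estError_le hC (P := P) hα₀ hα₁ (max B 0)
    (τ := θ / (2 * K)) (by positivity)
  refine ⟨N₀, ?_⟩
  intro Ω _ μ _ ξ hξ hlaw hind γ hγ0 hγs hγ2 N h₀ hh₀ lam₀ hlam₀ h lam hiter hB hN
  have hL : subspaceProj u M = Sᗮ.starProjection := funext (subspaceProj_eq_starProjection hu)
  rw [hL] at hiter
  have hNpos : ∀ k, 0 < N k := fun k => hN₀.trans_le (hN k)
  have hhm : ∀ k, Measurable[sampleFiltration hξ k] (h k) := fun k => by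
    have h1 := measurable_fst.comp (measurable_iter hC hα₀ hα₁ hcont hqm hJ
      (L := Sᗮ.starProjection) (Sᗮ.starProjection).continuous.measurable γ hNpos h₀ lam₀ hξ k)
    convert h1 using 1
    ext1 ω
    exact congrArg Prod.fst (hiter k ω)
  have hB' : ∀ᵐ ω ∂μ, ∀ k, ‖h k ω‖ ≤ max B 0 ∧ ‖lam k ω‖ ≤ max B 0 ∧
      ‖estError α P C (N k) (fun j => ξ k j ω) (h k ω)‖ ≤ max B 0 :=
    hB.mono fun ω hω k => ⟨(hω k).1.trans (le_max_left _ _), (hω k).2.1.trans (le_max_left _ _),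
      (hω k).2.2.trans (le_max_left _ _)⟩
  have hcompensator := ae_exists_compensator
    (f := fun k x y => ‖estError α P C (N k) y x‖)
    (fun k => (measurable_estError hC hα₀ hα₁ hcont (hNpos k)).norm)
    (fun _ _ _ => norm_nonneg _) hγ2 hξ hind hhm
    (hB'.mono fun ω hω k => (hω k).2.2) (τ := θ / (2 * K)) fun k x hx =>
      hest μ (ξ k) (hξ k) (hlaw k) (hind.precomp (g := fun j => (k, j))
        (fun i j hij => (Prod.mk.inj hij).2)) (N k) (hN k) x hx
  -- From here on the argument is deterministic along a single path.
  filter_upwards [hB', hcompensator] with ω hω hωc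
  obtain ⟨e, a, he, ha⟩ := hωc
  have hstep : ∀ k, (h (k + 1) ω, lam (k + 1) ω) =
      (h k ω - γ k • Sᗮ.starProjection (cvarMap α P C (h k ω) + combination g (lam k ω)
        + estError α P C (N k) (fun j => ξ k j ω) (h k ω)),
        dualStep (lam k ω) (γ k) (constraintVec q (h k ω))) := fun k => by
    have h1 := hiter k ω
    rw [hiter (k + 1) ω, iter, ← h1]
    simp only [hJ]
    rfl
  have h0 := hiter 0 ω
  rw [iter, Prod.mk.injEq] at h0
  have hev := eventually_norm_sub_le hθ hη hK hW hγ0 hγs hγ2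
    (fun k => (Prod.mk.inj (hstep k)).1) (fun k => (Prod.mk.inj (hstep k)).2)
    (by
      rw [h0.1, hS, mem_orthogonal_rows_iff, WithLp.ofLp_sub, Matrix.mulVec_sub, hh₀,
        hkkt.eq_constraint, sub_self])
    (by rw [h0.2]; exact hlam₀) hω he ha
  exact limsup_le_of_le (isCoboundedUnder_le_of_le atTop fun k => norm_nonneg _) hev
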